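/- Let $S$ and $A$ be Polish spaces, let $A(x)\subseteq A$ $(x\in S)$ be sets of admissible actions whose graph $K=\{(x,a):x\in S,\ a\in A(x)\}$ is Borel, and let $q(\cdot|x,a)$, $(x,a)\in K$, be finite signed measures on $\mathcal B(S)$ such that $(x,a)\mapsto q(D|x,a)$ is Borel on $K$ for every $D\in\mathcal B(S)$, $q(D|x,a)\ge 0$ if $x\notin D$, $q(S|x,a)=0$, and $q^*(x):=\sup_{a\in A(x)}|q(\{x\}|x,a)|<\infty$ for every $x\in S$. Add isolated points $x_\infty$ to $S$ and $a_\infty$ to $A$, with $A(x_\infty)=\{a_\infty\}$ and $q(\cdot|x_\infty,a_\infty)=0$. Let $\Omega$ be the space of sequences $e=(x_0,\theta_1,x_1,\theta_2,x_2,\dots)$ with $x_0\in S$, where either $\theta_k\in(0,\infty)$ and $x_k\in S$ for all $k\ge1$, or this holds for all $k<m$ and $(\theta_k,x_k)=(\infty,x_\infty)$ for all $k\ge m$, for some $m\ge 1$. Put $T_0=0$, $T_k=\theta_1+\dots+\theta_k$, $T_\infty=\lim_k T_k$. Let $\xi_t=x_k$ for $T_k\le t<T_{k+1}$ and $\xi_t=x_\infty$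 for $t\ge T_\infty$; let $\xi_{0-}=x_0$, $\xi_{t-}=x_k$ for $T_k<t\le T_{k+1}$, $t>0$, and $\xi_{t-}=x_\infty$ for $t\geq T_\infty$. Let $\mu^*=\sum_{k\ge0}I_{\{T_k<\infty\}}\delta_{(T_k,x_k)}$, $\mathcal F_t=\sigma(\mu^*([0,s]\times D):s\le t,\ D\in\mathcal B(S))$, and let $\mathcal P$ be the predictable $\sigma$-algebra of $(\mathcal F_t)$ on $\Omega\times[0,\infty)$. A policy $\pi$ is a transition probability $\pi(da|e,t)$ from $(\Omega\times[0,\infty),\mathcal P)$ to $A\cup\{a_\infty\}$ with $\pi(A(\xi_{t-}(e))|e,t)=1$ for all $(e,t)$. For a policy $\pi$ and $x\in S$, $P^\pi_x$ denotes the probability measure on $\Omega$ with $P^\pi_x(x_0=x)=1$ under which $$\nu^\pi(e,dt,dy)=\Big[\int\pi(da|e,t)\,q(dy\setminus\{\xi_{t-}(e)\}|\xi_{t-}(e),a)\Big]dt$$ is the dual predictable projection of the restriction of $\mu^*$ to $(0,\infty)\times S$, that is, $E^\pi_x\int_{(0,\infty)\times S} Y\,d\mu^*=E^\pi_x\int Y\,d\nu^\pi$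 for every nonnegative $\mathcal P\otimes\mathcal B(S)$-measurable $Y$; $E^\pi_x$ is its expectation. Assume that there are a continuous function $w\ge1$ on $S$, constants $\rho,b\ge0$ and sets $S_k\uparrow S$ such that (1) $\int_S w(y)\,q(dy|x,a)\le\rho w(x)+b$ for all $(x,a)\in K$ (the integral being finite); (2) $\inf_{x\notin S_k}w(x)\to\infty$ as $k\to\infty$, with $\inf\varnothing=\infty$; (3) $\sup_{x\in S_k,\,a\in A(x)}|q(\{x\}|x,a)|<\infty$ for every $k$. Then for every policy $\pi$, $x\in S$ and $t\ge0$: (a) $P^\pi_x(T_\infty=\infty)=1$ and $P^\pi_x(\xi_t\in S)=1$. (b) $w(\xi_t)$ is $P^\pi_x$-integrable, with $E^\pi_x[w(\xi_t)]\le e^{\rho t}w(x)+\frac b\rho(e^{\rho t}-1)$ if $\rho\ne0$, and $E^\pi_x[w(\xi_t)]\le w(x)+bt$ if $\rho=0$. (c) For every $D\in\mathcal B(S)$ with $\sup_{y\in D}q^*(y)<\infty$, $$P^\pi_x(\xi_t\in D)=I_D(x)+E^\pi_x\Big[\int_0^t\int\pi(da|e,s)\,q(D|\xi_{s-}(e),a)\,ds\Big],$$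 where $a\mapsto q(D|\xi_{s-}(e),a)$ is $\pi(\cdot|e,s)$-integrable for all $(e,s)$ and the inner integral is $P^\pi_x\otimes ds$-integrable on $\Omega\times(0,t]$. -/

import Mathlib

open MeasureTheory ProbabilityTheory Filter Topology
open scoped NNReal ENNReal

namespace CTMDP

/-- A state space or action space with one isolated point `Sum.inr ()` added
(the points `x_∞` and `a_∞`). -/
abbrev Ext (X : Type*) := X ⊕ Unit

/-- The sample space `Ω` of sequences `(x₀, θ₁, x₁, θ₂, x₂, …)`. The pair `(θ_{k+1}, x_{k+1})` is
`e.1.2 k`. Sojourn times are positive; either all of them are finite and all states lie in `S`, or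
from some index on all pairs equal `(∞, x_∞)`, and before that the times are finite and the states
lie in `S`. -/
def Path (S : Type*) : Type _ :=
  {e : S × (ℕ → ℝ≥0∞ × Ext S) //
    ∀ k, 0 < (e.2 k).1 ∧ ((e.2 k).1 = ∞ ↔ (e.2 k).2 = Sum.inr ()) ∧
      ((e.2 k).2 = Sum.inr () → (e.2 (k + 1)).2 = Sum.inr ())}

namespace Path

variable {S : Type*}

instance [MeasurableSpace S] : MeasurableSpace (Path S) :=
  inferInstanceAs (MeasurableSpace {e : S × (ℕ → ℝ≥0∞ × Ext S) //
    ∀ k, 0 < (e.2 k).1 ∧ ((e.2 k).1 = ∞ ↔ (e.2 k).2 = Sum.inr ()) ∧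
      ((e.2 k).2 = Sum.inr () → (e.2 (k + 1)).2 = Sum.inr ())})

/-- The initial state `x₀`. -/
def init (e : Path S) : S := e.1.1

/-- The state `X_k` after the `k`-th jump. -/
def state (e : Path S) : ℕ → Ext S
  | 0 => Sum.inl e.init
  | k + 1 => (e.1.2 k).2

/-- The jump epoch `T_k = θ₁ + ⋯ + θ_k`, with `T₀ = 0`. -/
noncomputable def jumpTime (e : Path S) (k : ℕ) : ℝ≥0∞ := ∑ i ∈ Finset.range k, (e.1.2 i).1

/-- The explosion time `T_∞ = lim T_k`. -/
noncomputable def explosionTime (e : Path S) : ℝ≥0∞ := ⨆ k, e.jumpTime k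

open Classical in
/-- The process `ξ_t`: it is `X_k` on `[T_k, T_{k+1})` and `x_∞` on `[T_∞, ∞)`. -/
noncomputable def xi (e : Path S) (t : ℝ≥0) : Ext S :=
  if h : ∃ k, e.jumpTime k ≤ t ∧ (t : ℝ≥0∞) < e.jumpTime (k + 1) then e.state h.choose
  else Sum.inr ()

open Classical in
/-- The left limit process `ξ_{t-}`: it is `x₀` at `t = 0`, `X_k` on `(T_k, T_{k+1}]`, and `x_∞`
on `[T_∞, ∞)`. -/
noncomputable def xiLeft (e : Path S) (t : ℝ≥0) : Ext S :=
  if t = 0 then Sum.inl e.init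
  else if h : ∃ k, e.jumpTime k < t ∧ (t : ℝ≥0∞) ≤ e.jumpTime (k + 1) then e.state h.choose
  else Sum.inr ()

/-- The random measure `μ* = ∑_{k ≥ 0} 1{T_k < ∞} δ_{(T_k, X_k)}` on `[0, ∞) × S`; on `Path S` one
has `T_k < ∞` exactly when `X_k` lies in `S`. -/
noncomputable def jumpMeasure [MeasurableSpace S] (e : Path S) : Measure (ℝ≥0 × S) :=
  Measure.sum fun k =>
    Sum.elim (fun y => Measure.dirac ((e.jumpTime k).toNNReal, y)) (fun _ => 0) (e.state k)

variable [MeasurableSpace S]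

lemma measurable_state (k : ℕ) : Measurable fun e : Path S => e.state k := by
  cases k with
  | zero => exact measurable_inl.comp (measurable_fst.comp measurable_subtype_coe)
  | succ k =>
    exact measurable_snd.comp ((measurable_pi_apply k).comp
      (measurable_snd.comp measurable_subtype_coe))

lemma measurable_jumpTime (k : ℕ) : Measurable fun e : Path S => e.jumpTime k := by
  refine Finset.measurable_sum _ fun i _ => ?_
  exact measurable_fst.comp ((measurable_pi_apply i).comp
      (measurable_snd.comp measurable_subtype_coe))

lemma measurable_sumElim_dirac {B : Set (ℝ≥0 × S)} (hB : MeasurableSet B) :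
    Measurable fun p : ℝ≥0∞ × Ext S =>
      (Sum.elim (fun y => Measure.dirac (p.1.toNNReal, y)) (fun _ => 0) p.2 :
        Measure (ℝ≥0 × S)) B := by
  let C : Set (ℝ≥0∞ × S) := (fun p => (p.1.toNNReal, p.2)) ⁻¹' B
  have hC : MeasurableSet C :=
    hB.preimage ((ENNReal.measurable_toNNReal.comp measurable_fst).prodMk measurable_snd)
  let i : ℝ≥0∞ × S → ℝ≥0∞ × Ext S := Prod.map id Sum.inl
  have hi : MeasurableEmbedding i := MeasurableEmbedding.id.prodMap
    ⟨Sum.inl_injective, measurable_inl, fun {_} hs => measurableSet_inl_image.2 hs⟩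
  have : (fun p : ℝ≥0∞ × Ext S =>
      (Sum.elim (fun y => Measure.dirac (p.1.toNNReal, y)) (fun _ => 0) p.2 :
        Measure (ℝ≥0 × S)) B) = (i '' C).indicator 1 := by
    funext ⟨t, z⟩
    rcases z with y | u
    · have hiff : (t, (Sum.inl y : Ext S)) ∈ i '' C ↔ (t.toNNReal, y) ∈ B :=
        ⟨by rintro ⟨⟨t', y'⟩, h, he⟩
            obtain ⟨rfl, hy⟩ := Prod.mk.inj he
            cases Sum.inl_injective hy
            exact h, fun h => ⟨(t, y), h, rfl⟩⟩
      simp only [Sum.elim_inl, Measure.dirac_apply' _ hB]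
      by_cases h : (t.toNNReal, y) ∈ B
      · rw [Set.indicator_of_mem h, Set.indicator_of_mem (hiff.2 h)]
        simp
      · rw [Set.indicator_of_notMem h, Set.indicator_of_notMem (mt hiff.1 h)]
    · have h : (t, (Sum.inr u : Ext S)) ∉ i '' C := by
        rintro ⟨⟨t', y'⟩, -, he⟩
        exact Sum.inl_ne_inr (Prod.mk.inj he).2
      rw [Set.indicator_of_notMem h]
      simp
  rw [this]
  exact measurable_one.indicator (hi.measurableSet_image.2 hC)

lemma measurable_jumpMeasure {B : Set (ℝ≥0 × S)} (hB : MeasurableSet B) :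
    Measurable fun e : Path S => e.jumpMeasure B := by
  simp only [jumpMeasure, Measure.sum_apply _ hB]
  refine Measurable.tsum fun k => ?_
  have h : Measurable fun e : Path S => (e.jumpTime k, e.state k) :=
    (measurable_jumpTime k).prodMk (measurable_state k)
  have := (measurable_sumElim_dirac hB).comp h
  simpa only [Function.comp_def] using this

/-- The filtration `F_t = σ(μ*([0, s] × D) : s ≤ t, D Borel)`. -/
noncomputable def filtration (S : Type*) [MeasurableSpace S] :
    Filtration ℝ≥0 (inferInstance : MeasurableSpace (Path S)) where
  seq t := ⨆ (s : ℝ≥0) (_ : s ≤ t) (D : Set S) (_ : MeasurableSet D),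
    MeasurableSpace.comap (fun e : Path S => e.jumpMeasure (Set.Iic s ×ˢ D)) inferInstance
  mono' _ _ h := iSup_mono fun _ => iSup_mono' fun hs => ⟨hs.trans h, le_rfl⟩
  le' _ := iSup₂_le fun _ _ => iSup₂_le fun _ hD =>
    (measurable_jumpMeasure (measurableSet_Iic.prod hD)).comap_le

end Path

/-- The data of a controlled continuous-time jump process: admissible action sets `A(x)` with
Borel graph `K` and conservative, stable, signed transition rates `q(·|x,a)`. Only the values of
`q` on `K` matter. -/
structure Model (S A : Type*) [MeasurableSpace S] [MeasurableSpace A] where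
  adm : S → Set A
  measurableSet_graph : MeasurableSet {p : S × A | p.2 ∈ adm p.1}
  q : S → A → SignedMeasure S
  measurable_q : ∀ D : Set S, MeasurableSet D →
    Measurable fun p : {p : S × A // p.2 ∈ adm p.1} => q p.1.1 p.1.2 D
  q_nonneg : ∀ x, ∀ a ∈ adm x, ∀ D : Set S, MeasurableSet D → x ∉ D → 0 ≤ q x a D
  q_univ : ∀ x, ∀ a ∈ adm x, q x a Set.univ = 0
  stable : ∀ x, (⨆ a ∈ adm x, ‖q x a {x}‖ₑ) < ∞

namespace Model

variable {S A : Type*} [MeasurableSpace S] [MeasurableSpace A] (M : Model S A)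

/-- `q*(x) = sup_{a ∈ A(x)} |q({x}|x,a)|`. -/
noncomputable def qStar (x : S) : ℝ≥0∞ := ⨆ a ∈ M.adm x, ‖M.q x a {x}‖ₑ

/-- The admissible actions on `S_∞`, with `A(x_∞) = {a_∞}`. -/
def admExt : Ext S → Set (Ext A)
  | Sum.inl x => Sum.inl '' M.adm x
  | Sum.inr _ => {Sum.inr ()}

/-- The transition rates on `S_∞`, with `q(·|x_∞, a_∞) = 0`. -/
noncomputable def qExt : Ext S → Ext A → SignedMeasure S
  | Sum.inl x, Sum.inl a => M.q x a
  | _, _ => 0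

/-- The positive measure `D ↦ q(D \ {x}|x,a)` of jump rates out of `x`, extended by `0` to
`x_∞`. -/
noncomputable def jumpRate : Ext S → Ext A → Measure S
  | Sum.inl x, Sum.inl a => (M.q x a).toJordanDecomposition.posPart.restrict {x}ᶜ
  | _, _ => 0

lemma jumpRate_apply [MeasurableSingletonClass S] {x : S} {a : A} (ha : a ∈ M.adm x) {D : Set S}
    (hD : MeasurableSet D) :
    M.jumpRate (Sum.inl x) (Sum.inl a) D = ENNReal.ofReal (M.q x a (D \ {x})) := by
  have hx : MeasurableSet (D \ {x}) := hD.diff (measurableSet_singleton x)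
  have hneg : (M.q x a).toJordanDecomposition.negPart (D \ {x}) = 0 := by
    obtain ⟨i, hi, h₁, h₂, -, hn⟩ := (M.q x a).toJordanDecomposition_spec
    rw [hn, SignedMeasure.toMeasureOfLEZero_apply _ h₂ hi.compl hx]
    have hle : M.q x a (iᶜ ∩ (D \ {x})) ≤ 0 :=
      VectorMeasure.nonpos_of_restrict_le_zero _
        (VectorMeasure.restrict_le_restrict_subset _ _ hi.compl h₂ Set.inter_subset_left)
    have hge := M.q_nonneg x a ha (iᶜ ∩ (D \ {x})) (hi.compl.inter hx) (by simp)
    have h0 : M.q x a (iᶜ ∩ (D \ {x})) = 0 := le_antisymm hle hge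
    simp [h0]
  have hq := SignedMeasure.toSignedMeasure_toJordanDecomposition (M.q x a)
  have hq' : M.q x a (D \ {x}) = (M.q x a).toJordanDecomposition.posPart.real (D \ {x}) := by
    conv_lhs => rw [← hq]
    simp [JordanDecomposition.toSignedMeasure, hx, Measure.real, hneg]
  rw [jumpRate, Measure.restrict_apply hD, hq', ← Set.sdiff_eq]
  simp [Measure.real]

/-- A policy: a transition probability from `[0, ∞) × Ω` with the predictable σ-algebra to `A_∞`
that charges only the actions admissible at `ξ_{t-}`. -/
structure Policy where
  kernel : @Kernel (ℝ≥0 × Path S) (Ext A) (Path.filtration S).predictable inferInstance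
  isMarkovKernel : @IsMarkovKernel _ _ (Path.filtration S).predictable inferInstance kernel
  kernel_adm : ∀ (t : ℝ≥0) (e : Path S), kernel (t, e) (M.admExt (e.xiLeft t)) = 1

/-- `P` is the law `P^π_γ` of the controlled process: a probability measure on `Ω` under which
`x₀` has distribution `γ` and the random measure
`ν^π(e, dt, dy) = [∫ π(da|e,t) q(dy \ {ξ_{t-}}|ξ_{t-}, a)] dt`
is the dual predictable projection (the compensator) of the random measure `μ*` of the jumps,
that is, `μ*` on `(0, ∞) × S` and `ν^π` give the same expected integral to every nonnegative
predictable function `Y`. -/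
structure IsLaw {M : Model S A} (π : M.Policy) (γ : Measure S) (P : Measure (Path S)) : Prop where
  isProbabilityMeasure : IsProbabilityMeasure P
  map_init : P.map Path.init = γ
  compensator : ∀ Y : (ℝ≥0 × Path S) × S → ℝ≥0∞,
    Measurable[(Path.filtration S).predictable.prod inferInstance] Y →
    ∫⁻ e, ∫⁻ z in Set.Ioi 0 ×ˢ Set.univ, Y ((z.1, e), z.2) ∂e.jumpMeasure ∂P =
      ∫⁻ e, (∫⁻ t in Set.Ioi (0 : ℝ), (∫⁻ a, ∫⁻ y, Y ((t.toNNReal, e), y)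
        ∂M.jumpRate (e.xiLeft t.toNNReal) a ∂π.kernel (t.toNNReal, e))) ∂P

/-- The nonexplosion condition, with Lyapunov function `w`, constants `ρ`, `b` and level
sets `L k`. -/
structure Nonexplosion [TopologicalSpace S] (w : S → ℝ) (ρ b : ℝ) (L : ℕ → Set S) : Prop where
  continuous : Continuous w
  one_le : ∀ x, 1 ≤ w x
  rho_nonneg : 0 ≤ ρ
  b_nonneg : 0 ≤ b
  integrable : ∀ x, ∀ a ∈ M.adm x, (M.q x a).Integrable w
  drift : ∀ x, ∀ a ∈ M.adm x, ∫ᵛ y, w y ∂•(M.q x a) ≤ ρ * w x + b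
  tendsto_inf : Tendsto (fun k => ⨅ x ∈ (L k)ᶜ, ENNReal.ofReal (w x)) atTop (𝓝 ∞)
  mono : Monotone L
  iUnion_eq : ⋃ k, L k = Set.univ
  bounded : ∀ k, (⨆ x ∈ L k, M.qStar x) < ∞

end Model

end CTMDP

/-! The compensator identity is tested only on integrands `1_Z(t, e) F(ξ_{t-}, y)` with `Z`
predictable. It then says that the expected sum of `F` over the transitions occurring in `Z` is the
expected time integral of `π.rate F` over `Z`. Taking for `Z` the times before the `N`-th jump and
before the exit from a set `V`, and telescoping a function `f` along the jumps, gives Dynkin's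
formula (`IsLaw.lintegral_stopped_add`). All balances have the additive form `f z + F (z, z') = f z'
+ G (z, z')`, so that everything stays in `[0, ∞]` and nothing is subtracted before it is known to
be finite.

For (a) and (b), stop at the exit from a sublevel set `{w ≤ c}`. There `q*` is bounded by
assumptions (2) and (3), so the Dynkin terms are finite and the drift condition can be applied;
Grönwall's inequality bounds the expected stopped value of `w` by a constant independent of `c` and
`N` (`lintegral_stopped_le_gronwallBound`). If explosion occurs by time `t`, then either `N` jumps
occur by `t` with all earlier states in `{w ≤ c}`, an event of probability `O(1/N)`, or the stopped
value of `w` exceeds `c`, which by Markov's inequality has probability `O(1/c)` uniformly in `N`.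
Letting `N → ∞` and then `c → ∞` excludes explosion (`measure_explosionTime_le`); Fatou's lemma
gives the moment bound.

For (c), without explosion the indicator of `D` at time `t` is its initial value plus entrances
minus exits. Since `q(D|x,a)` is nonnegative for `x ∉ D` and nonpositive for `x ∈ D`, the entrance
and exit rates are the positive and negative parts of `π.drift D`. Exits have rate at most `sup_D
q*`, so their expected number is finite, hence so is that of entrances, and the two may be
subtracted. -/

namespace CTMDP

namespace Path

/-! ### Jump epochs and states along a single path. -/

section Pathwise

variable {S : Type*} (e : Path S)

lemma jumpTime_zero : e.jumpTime 0 = 0 := by simp [jumpTime]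

lemma jumpTime_succ (k : ℕ) : e.jumpTime (k + 1) = e.jumpTime k + (e.1.2 k).1 := by
  simp [jumpTime, Finset.sum_range_succ]

lemma jumpTime_mono : Monotone e.jumpTime :=
  monotone_nat_of_le_succ fun k => by simp [jumpTime_succ]

lemma jumpTime_lt_succ {k : ℕ} (h : e.jumpTime k ≠ ∞) : e.jumpTime k < e.jumpTime (k + 1) := by
  rw [jumpTime_succ]
  exact ENNReal.lt_add_right h (e.2 k).1.ne'

lemma state_succ_eq_inr {k : ℕ} (h : e.state k = Sum.inr ()) : e.state (k + 1) = Sum.inr () := by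
  cases k with
  | zero => exact absurd h Sum.inl_ne_inr
  | succ k => exact (e.2 k).2.2 h

lemma jumpTime_eq_top_iff (k : ℕ) : e.jumpTime k = ∞ ↔ e.state k = Sum.inr () := by
  induction k with
  | zero => simp [jumpTime_zero, state]
  | succ k ih =>
    rw [jumpTime_succ, ENNReal.add_eq_top, ih]
    have h : (e.1.2 k).1 = ∞ ↔ e.state (k + 1) = Sum.inr () := (e.2 k).2.1
    rw [h]
    exact ⟨fun h => h.elim e.state_succ_eq_inr id, Or.inr⟩

lemma exists_state_eq_inl {k : ℕ} (h : e.jumpTime k ≠ ∞) : ∃ y, e.state k = Sum.inl y := by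
  rcases hs : e.state k with y | u
  · exact ⟨y, rfl⟩
  · exact absurd ((e.jumpTime_eq_top_iff k).2 hs) h

lemma jumpTime_ne_top {k : ℕ} {y : S} (h : e.state k = Sum.inl y) : e.jumpTime k ≠ ∞ := by
  simp [Ne, e.jumpTime_eq_top_iff, h]

lemma jumpTime_pos (k : ℕ) : 0 < e.jumpTime (k + 1) := by
  have := e.jumpTime_lt_succ (k := 0) (by simp [jumpTime_zero])
  rw [jumpTime_zero] at this
  exact this.trans_le (e.jumpTime_mono (by lia))

/-- A finite jump epoch precedes another one exactly when its index does. -/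
lemma le_of_jumpTime_le {j k : ℕ} (hj : e.jumpTime j ≠ ∞) (h : e.jumpTime j ≤ e.jumpTime k) :
    j ≤ k := by
  by_contra! hlt
  have hk : e.jumpTime k ≠ ∞ := ne_top_of_le_ne_top hj (e.jumpTime_mono hlt.le)
  exact absurd ((e.jumpTime_lt_succ hk).trans_le (e.jumpTime_mono hlt)) h.not_gt

lemma xiLeft_eq_state {k : ℕ} {s : ℝ≥0} (h₁ : e.jumpTime k < s) (h₂ : s ≤ e.jumpTime (k + 1)) :
    e.xiLeft s = e.state k := by
  have hs : s ≠ 0 := by rintro rfl; simp at h₁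
  have h : ∃ k, e.jumpTime k < s ∧ (s : ℝ≥0∞) ≤ e.jumpTime (k + 1) := ⟨k, h₁, h₂⟩
  have hc := h.choose_spec
  have hk : h.choose = k := by
    have a := e.jumpTime_mono.reflect_lt (hc.1.trans_le h₂)
    have b := e.jumpTime_mono.reflect_lt (h₁.trans_le hc.2)
    lia
  rw [xiLeft, if_neg hs, dif_pos h, hk]

lemma xiLeft_eq_inr {s : ℝ≥0} (hs : s ≠ 0)
    (h : ¬∃ k, e.jumpTime k < s ∧ (s : ℝ≥0∞) ≤ e.jumpTime (k + 1)) :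
    e.xiLeft s = Sum.inr () := by
  rw [xiLeft, if_neg hs, dif_neg h]

lemma xi_eq_state {k : ℕ} {t : ℝ≥0} (h₁ : e.jumpTime k ≤ t) (h₂ : t < e.jumpTime (k + 1)) :
    e.xi t = e.state k := by
  have h : ∃ k, e.jumpTime k ≤ t ∧ (t : ℝ≥0∞) < e.jumpTime (k + 1) := ⟨k, h₁, h₂⟩
  have hc := h.choose_spec
  have hk : h.choose = k := by
    have a := e.jumpTime_mono.reflect_lt (hc.1.trans_lt h₂)
    have b := e.jumpTime_mono.reflect_lt (h₁.trans_lt hc.2)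
    lia
  rw [xi, dif_pos h, hk]

lemma xi_eq_inr {t : ℝ≥0}
    (h : ¬∃ k, e.jumpTime k ≤ t ∧ (t : ℝ≥0∞) < e.jumpTime (k + 1)) :
    e.xi t = Sum.inr () := by
  rw [xi, dif_neg h]

lemma exists_jumpTime_le_lt {t : ℝ≥0∞} (h : t < e.explosionTime) :
    ∃ k, e.jumpTime k ≤ t ∧ t < e.jumpTime (k + 1) := by
  classical
  have hex : ∃ k, t < e.jumpTime k := lt_iSup_iff.1 h
  have hpos : Nat.find hex ≠ 0 := by
    intro h0
    have := Nat.find_spec hex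
    rw [h0, jumpTime_zero] at this
    simp at this
  obtain ⟨k, hk⟩ := Nat.exists_eq_succ_of_ne_zero hpos
  refine ⟨k, not_lt.1 (Nat.find_min hex (by lia)), ?_⟩
  have := Nat.find_spec hex
  rwa [hk] at this

end Pathwise

/-! ### Reading epochs and states off the random measure. -/

section Adapted

variable {S : Type*} [MeasurableSpace S]

lemma jumpMeasure_Iic_prod (e : Path S) (s : ℝ≥0) {D : Set S} (hD : MeasurableSet D) :
    e.jumpMeasure (Set.Iic s ×ˢ D) =
      ∑' j, {j | e.jumpTime j ≤ s ∧ e.state j ∈ Sum.inl '' D}.indicator 1 j := by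
  rw [jumpMeasure, Measure.sum_apply _ (measurableSet_Iic.prod hD)]
  congr 1
  ext j
  rcases hs : e.state j with y | u
  · have ht := e.jumpTime_ne_top hs
    have : (e.jumpTime j).toNNReal ≤ s ↔ e.jumpTime j ≤ s := by
      conv_rhs => rw [← ENNReal.coe_toNNReal ht, ENNReal.coe_le_coe]
    have hmem : ((e.jumpTime j).toNNReal, y) ∈ Set.Iic s ×ˢ D ↔
        j ∈ {j | e.jumpTime j ≤ s ∧ e.state j ∈ Sum.inl '' D} := by
      simp [this, hs]
    rw [Sum.elim_inl, Measure.dirac_apply' _ (measurableSet_Iic.prod hD)]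
    by_cases h : j ∈ {j | e.jumpTime j ≤ s ∧ e.state j ∈ Sum.inl '' D}
    · rw [Set.indicator_of_mem h, Set.indicator_of_mem (hmem.2 h)]
      rfl
    · rw [Set.indicator_of_notMem h, Set.indicator_of_notMem (mt hmem.1 h)]
  · simp [hs]

lemma measurable_jumpMeasure_filtration {s t : ℝ≥0} (h : s ≤ t) {D : Set S}
    (hD : MeasurableSet D) :
    Measurable[filtration S t] fun e : Path S => e.jumpMeasure (Set.Iic s ×ˢ D) := by
  refine Measurable.of_comap_le ?_
  exact le_iSup₂_of_le (f := fun (s : ℝ≥0) (_ : s ≤ t) => ⨆ (D : Set S) (_ : MeasurableSet D),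
    MeasurableSpace.comap (fun e : Path S => e.jumpMeasure (Set.Iic s ×ˢ D)) inferInstance) s h
    (le_iSup₂_of_le (f := fun (D : Set S) (_ : MeasurableSet D) =>
    MeasurableSpace.comap (fun e : Path S => e.jumpMeasure (Set.Iic s ×ˢ D)) inferInstance)
    D hD le_rfl)

/-- The count is `k + 1` because `T_0 = 0` contributes an atom. Through this equivalence the epochs
become stopping times of a filtration that is generated by `μ*` alone. -/
lemma jumpTime_le_iff (e : Path S) (k : ℕ) (s : ℝ≥0) :
    e.jumpTime k ≤ s ↔ ((k + 1 : ℕ) : ℝ≥0∞) ≤ e.jumpMeasure (Set.Iic s ×ˢ Set.univ) := by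
  have hset : ∀ j, e.jumpTime j ≤ s → e.state j ∈ Sum.inl '' (Set.univ : Set S) := fun j hj => by
    obtain ⟨y, hy⟩ := e.exists_state_eq_inl (ne_top_of_le_ne_top ENNReal.coe_ne_top hj)
    exact ⟨y, trivial, hy.symm⟩
  rw [jumpMeasure_Iic_prod e s MeasurableSet.univ]
  constructor
  · intro h
    refine le_trans ?_ (ENNReal.sum_le_tsum (Finset.range (k + 1)))
    rw [Finset.sum_congr rfl (g := fun _ => 1)]
    · simp
    · intro j hj
      have hjs : e.jumpTime j ≤ s :=
        (e.jumpTime_mono (Nat.lt_succ_iff.1 (Finset.mem_range.1 hj))).trans h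
      exact Set.indicator_of_mem (s := {j | e.jumpTime j ≤ s ∧ _}) ⟨hjs, hset j hjs⟩ _
  · intro h
    by_contra! hlt
    rw [tsum_eq_sum (s := Finset.range k)] at h
    · have := h.trans (Finset.sum_le_sum fun j _ =>
        Set.indicator_le_self' (f := (1 : ℕ → ℝ≥0∞)) (fun _ _ => zero_le) j)
      simp only [Pi.one_apply, Finset.sum_const, Finset.card_range, nsmul_eq_mul, mul_one,
        Nat.cast_le] at this
      lia
    · intro j hj
      refine Set.indicator_of_notMem (fun hj' => ?_) _
      exact (hj'.1.trans_lt hlt).not_ge (e.jumpTime_mono (not_lt.1 (mt Finset.mem_range.2 hj)))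

lemma measurableSet_jumpTime_le {s t : ℝ≥0} (h : s ≤ t) (k : ℕ) :
    MeasurableSet[filtration S t] {e : Path S | e.jumpTime k ≤ s} := by
  simp only [jumpTime_le_iff]
  exact measurable_jumpMeasure_filtration h .univ measurableSet_Ici

lemma mem_of_jumpMeasure_lt (e : Path S) {r s : ℝ≥0} {D : Set S} (hD : MeasurableSet D)
    (h : e.jumpMeasure (Set.Iic r ×ˢ D) < e.jumpMeasure (Set.Iic s ×ˢ D)) :
    ∃ j, r < e.jumpTime j ∧ e.jumpTime j ≤ s ∧ e.state j ∈ Sum.inl '' D := by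
  by_contra! hno
  rw [jumpMeasure_Iic_prod e _ hD, jumpMeasure_Iic_prod e _ hD] at h
  refine h.not_ge (ENNReal.tsum_le_tsum fun j => ?_)
  refine Set.indicator_le_indicator_of_subset (fun j hj => ?_) (fun _ => zero_le) j
  exact ⟨not_lt.1 fun hlt => hno j hlt hj.1 hj.2, hj.2⟩

lemma jumpMeasure_lt_of_mem (e : Path S) {k : ℕ} {r s : ℝ≥0} {D : Set S} (hD : MeasurableSet D)
    (h₁ : r < e.jumpTime k) (h₂ : e.jumpTime k ≤ s) (hk : e.state k ∈ Sum.inl '' D) :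
    e.jumpMeasure (Set.Iic r ×ˢ D) < e.jumpMeasure (Set.Iic s ×ˢ D) := by
  rw [jumpMeasure_Iic_prod e _ hD, jumpMeasure_Iic_prod e _ hD]
  rw [tsum_eq_sum (s := Finset.range k)]
  · refine lt_of_lt_of_le ?_ (ENNReal.sum_le_tsum (Finset.range (k + 1)))
    rw [Finset.sum_range_succ, Set.indicator_of_mem
      (s := {j | e.jumpTime j ≤ s ∧ e.state j ∈ Sum.inl '' D}) ⟨h₂, hk⟩]
    refine (Finset.sum_le_sum fun j _ => ?_).trans_lt (ENNReal.lt_add_right ?_ one_ne_zero)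
    · have hsub : {j | e.jumpTime j ≤ r ∧ e.state j ∈ Sum.inl '' D} ⊆
          {j | e.jumpTime j ≤ s ∧ e.state j ∈ Sum.inl '' D} :=
        fun j hj => ⟨(hj.1.trans h₁.le).trans h₂, hj.2⟩
      exact Set.indicator_le_indicator_of_subset hsub (fun _ => zero_le) j
    · refine ENNReal.sum_ne_top.2 fun j _ => ne_top_of_le_ne_top ENNReal.one_ne_top ?_
      exact Set.indicator_le_self' (f := (1 : ℕ → ℝ≥0∞)) (fun _ _ => zero_le) j
  · intro j hj
    refine Set.indicator_of_notMem (fun hj' => ?_) _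
    exact (hj'.1.trans_lt h₁).not_ge (e.jumpTime_mono (not_lt.1 (mt Finset.mem_range.2 hj)))

/-- The event that the `k`-th jump has occurred by time `q` and led into `V` belongs to `F_q`. -/
lemma measurableSet_jumpTime_le_state_mem (q : ℝ≥0) (k : ℕ) {V : Set (Ext S)}
    (hV : MeasurableSet V) :
    MeasurableSet[filtration S q] {e : Path S | e.jumpTime k ≤ q ∧ e.state k ∈ V} := by
  set D : Set S := Sum.inl ⁻¹' V with hDdef
  have hD : MeasurableSet D := measurable_inl hV
  have hmem : ∀ (e : Path S) (j : ℕ), e.state j ∈ Sum.inl '' D → e.state j ∈ V := by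
    rintro e j ⟨y, hy, h⟩
    rwa [← h]
  have hmem' : ∀ (e : Path S) (j : ℕ), e.jumpTime j ≤ q → e.state j ∈ V →
      e.state j ∈ Sum.inl '' D := by
    intro e j hj hV
    obtain ⟨y, hy⟩ := e.exists_state_eq_inl (ne_top_of_le_ne_top ENNReal.coe_ne_top hj)
    exact ⟨y, by rwa [hDdef, Set.mem_preimage, ← hy], hy.symm⟩
  cases k with
  | zero =>
    -- The only atom of `μ*` at time `0` is `(0, x_0)`, since all later epochs are positive.
    have : {e : Path S | e.jumpTime 0 ≤ q ∧ e.state 0 ∈ V} =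
        {e : Path S | e.jumpMeasure (Set.Iic 0 ×ˢ D) ≠ 0} := by
      ext e
      simp only [Set.mem_ofPred_eq, jumpMeasure_Iic_prod e 0 hD, ne_eq, ENNReal.tsum_eq_zero,
        not_forall]
      constructor
      · rintro ⟨h0, h⟩
        exact ⟨0, by
          rw [Set.indicator_of_mem (by exact ⟨by simp [jumpTime_zero], hmem' e 0 h0 h⟩)]; simp⟩
      · rintro ⟨j, hj⟩
        have hj' := Set.mem_of_indicator_ne_zero hj
        cases j with
        | zero => exact ⟨by simp [jumpTime_zero], hmem e 0 hj'.2⟩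
        | succ j =>
          have := hj'.1
          simp only [ENNReal.coe_zero, nonpos_iff_eq_zero] at this
          exact absurd this (e.jumpTime_pos j).ne'
    rw [this]
    exact measurable_jumpMeasure_filtration zero_le hD (measurableSet_singleton 0).compl
  | succ k =>
    obtain ⟨Q, hQc, hQd⟩ := TopologicalSpace.exists_countable_dense ℝ≥0
    -- Choose `T_k ≤ r < T_{k+1} ≤ s < T_{k+2}`: then `T_{k+1}` is the only epoch in `(r, s]`, and
    -- `μ*([0, ·] × D)` grows between `r` and `s` exactly when the new state lies in `D`. The point
    -- `q` is added to the dense set because no `s ≤ q` in that set need exist when `T_{k+1} = q`.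
    have : {e : Path S | e.jumpTime (k + 1) ≤ q ∧ e.state (k + 1) ∈ V} =
        ⋃ r ∈ insert q Q, ⋃ (_ : r ≤ q), ⋃ s ∈ insert q Q, ⋃ (_ : s ≤ q),
          ({e : Path S | e.jumpTime k ≤ r} ∩ {e : Path S | e.jumpTime (k + 1) ≤ s} ∩
            {e : Path S | e.jumpTime (k + 2) ≤ s}ᶜ ∩
            {e : Path S | e.jumpMeasure (Set.Iic r ×ˢ D) < e.jumpMeasure (Set.Iic s ×ˢ D)}) := by
      ext e
      simp only [Set.mem_iUnion, Set.mem_inter_iff, Set.mem_compl_iff, Set.mem_ofPred_eq,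
        exists_prop, not_le]
      constructor
      · rintro ⟨hq, hV⟩
        have hfin : e.jumpTime (k + 1) ≠ ∞ := ne_top_of_le_ne_top ENNReal.coe_ne_top hq
        have hlt := e.jumpTime_lt_succ (ne_top_of_le_ne_top hfin (e.jumpTime_mono k.le_succ))
        have hlt' := e.jumpTime_lt_succ hfin
        have hbetween : ∀ a b : ℝ≥0∞, a < b → ∃ r ∈ Q, a < (r : ℝ≥0) ∧ ((r : ℝ≥0) : ℝ≥0∞) < b := by
          intro a b hab
          obtain ⟨c, hac, hcb⟩ := ENNReal.lt_iff_exists_nnreal_btwn.1 hab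
          obtain ⟨d, hcd, hdb⟩ := ENNReal.lt_iff_exists_nnreal_btwn.1 hcb
          obtain ⟨r, hr, hr1, hr2⟩ := hQd.exists_between (ENNReal.coe_lt_coe.1 hcd)
          exact ⟨r, hr, hac.trans (ENNReal.coe_lt_coe.2 hr1), (ENNReal.coe_lt_coe.2 hr2).trans hdb⟩
        obtain ⟨r, hrQ, hr1, hr2⟩ := hbetween _ _ hlt
        refine ⟨r, Or.inr hrQ, ENNReal.coe_le_coe.1 (hr2.le.trans hq), ?_⟩
        have hs : ∃ s ∈ insert q Q, s ≤ q ∧ e.jumpTime (k + 1) ≤ s ∧ s < e.jumpTime (k + 2) := by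
          by_cases hq2 : q < e.jumpTime (k + 2)
          · exact ⟨q, Or.inl rfl, le_rfl, hq, hq2⟩
          · obtain ⟨s, hsQ, hs1, hs2⟩ := hbetween _ _ hlt'
            exact ⟨s, Or.inr hsQ, ENNReal.coe_le_coe.1 (hs2.le.trans (not_lt.1 hq2)), hs1.le, hs2⟩
        obtain ⟨s, hsQ, hsq, hs1, hs2⟩ := hs
        exact ⟨s, hsQ, hsq, ⟨⟨hr1.le, hs1⟩, hs2⟩,
          jumpMeasure_lt_of_mem e hD hr2 hs1 (hmem' e _ hq hV)⟩
      · rintro ⟨r, -, hrq, s, -, hsq, ⟨⟨h1, h2⟩, h3⟩, h4⟩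
        obtain ⟨j, hj1, hj2, hj3⟩ := mem_of_jumpMeasure_lt e hD h4
        have a := e.jumpTime_mono.reflect_lt (h1.trans_lt hj1)
        have b := e.jumpTime_mono.reflect_lt (hj2.trans_lt h3)
        obtain rfl : j = k + 1 := by lia
        exact ⟨h2.trans (ENNReal.coe_le_coe.2 hsq), hmem e _ hj3⟩
    rw [this]
    have hc : (insert q Q).Countable := hQc.insert q
    refine MeasurableSet.biUnion hc fun r _ => MeasurableSet.iUnion fun hr =>
      MeasurableSet.biUnion hc fun s _ => MeasurableSet.iUnion fun hs => ?_
    refine MeasurableSet.inter (MeasurableSet.inter (MeasurableSet.inter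
      (measurableSet_jumpTime_le hr k) (measurableSet_jumpTime_le hs _))
      (measurableSet_jumpTime_le hs _).compl) ?_
    exact measurableSet_lt (measurable_jumpMeasure_filtration hr hD)
      (measurable_jumpMeasure_filtration hs hD)

end Adapted

/-! ### Predictability of the left-limit process. -/

section Predictable

variable {S : Type*} [MeasurableSpace S]

lemma predictable_le_prod :
    (filtration S).predictable ≤ (inferInstance : MeasurableSpace (ℝ≥0 × Path S)) :=
  measurableSpace_le_predictable_of_measurableSet
    (fun _ hA => (measurableSet_singleton _).prod ((filtration S).le _ _ hA))
    (fun _ _ hA => measurableSet_Ioi.prod ((filtration S).le _ _ hA))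

lemma measurable_fst_predictable :
    Measurable[(filtration S).predictable] (Prod.fst : ℝ≥0 × Path S → ℝ≥0) := by
  let _ : MeasurableSpace (ℝ≥0 × Path S) := (filtration S).predictable
  refine measurable_of_Ioi fun i => ?_
  have := measurableSet_predictable_Ioi_prod (𝓕 := filtration S) (i := i) (s := Set.univ)
    MeasurableSet.univ
  convert this using 1
  ext p
  simp

/-- The strict inequality leaves room for a point `r` of a countable dense set with `T_k ≤ r < s`,
so the set is a countable union of generating rectangles `(r, ∞) × B` with `B ∈ F_r`. -/
lemma measurableSet_predictable_jumpTime_lt (k : ℕ) {V : Set (Ext S)} (hV : MeasurableSet V) :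
    MeasurableSet[(filtration S).predictable]
      {p : ℝ≥0 × Path S | p.2.jumpTime k < p.1 ∧ p.2.state k ∈ V} := by
  obtain ⟨Q, hQc, hQd⟩ := TopologicalSpace.exists_countable_dense ℝ≥0
  have : {p : ℝ≥0 × Path S | p.2.jumpTime k < p.1 ∧ p.2.state k ∈ V} =
      ⋃ r ∈ Q, Set.Ioi r ×ˢ {e : Path S | e.jumpTime k ≤ r ∧ e.state k ∈ V} := by
    ext ⟨s, e⟩
    simp only [Set.mem_ofPred_eq, Set.mem_iUnion, Set.mem_prod, Set.mem_Ioi, exists_prop]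
    constructor
    · rintro ⟨h, hV⟩
      obtain ⟨c, hc1, hc2⟩ := ENNReal.lt_iff_exists_nnreal_btwn.1 h
      obtain ⟨r, hr, hr1, hr2⟩ := hQd.exists_between (ENNReal.coe_lt_coe.1 hc2)
      exact ⟨r, hr, hr2, hc1.le.trans (ENNReal.coe_le_coe.2 hr1.le), hV⟩
    · rintro ⟨r, -, hr, h, hV⟩
      exact ⟨h.trans_lt (ENNReal.coe_lt_coe.2 hr), hV⟩
  rw [this]
  exact MeasurableSet.biUnion hQc fun r _ =>
    measurableSet_predictable_Ioi_prod (measurableSet_jumpTime_le_state_mem r k hV)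

lemma measurableSet_predictable_le_jumpTime (k : ℕ) :
    MeasurableSet[(filtration S).predictable]
      {p : ℝ≥0 × Path S | (p.1 : ℝ≥0∞) ≤ p.2.jumpTime k} := by
  have := (measurableSet_predictable_jumpTime_lt (S := S) k MeasurableSet.univ).compl
  convert this using 1
  ext p
  simp

/-- The process `ξ_{t-}` is predictable. -/
lemma measurable_xiLeft_predictable :
    Measurable[(filtration S).predictable] fun p : ℝ≥0 × Path S => p.2.xiLeft p.1 := by
  intro V hV
  have h0 : MeasurableSet[(filtration S).predictable]
      (({⊥} : Set ℝ≥0) ×ˢ {e : Path S | e.jumpTime 0 ≤ (⊥ : ℝ≥0) ∧ e.state 0 ∈ V}) :=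
    measurableSet_predictable_singleton_bot_prod (measurableSet_jumpTime_le_state_mem _ 0 hV)
  have hk : ∀ (k : ℕ) {V : Set (Ext S)}, MeasurableSet V →
      MeasurableSet[(filtration S).predictable] {p : ℝ≥0 × Path S |
        (p.2.jumpTime k < p.1 ∧ p.2.state k ∈ V) ∧ (p.1 : ℝ≥0∞) ≤ p.2.jumpTime (k + 1)} :=
    fun k V hV => (measurableSet_predictable_jumpTime_lt k hV).inter
      (measurableSet_predictable_le_jumpTime (k + 1))
  have hpos : MeasurableSet[(filtration S).predictable] {p : ℝ≥0 × Path S | p.1 ≠ 0} :=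
    measurable_fst_predictable (measurableSet_singleton 0).compl
  have hC : MeasurableSet[(filtration S).predictable] {p : ℝ≥0 × Path S | Sum.inr () ∈ V} :=
    MeasurableSet.const _
  -- The three pieces are time `0`, the intervals `(T_k, T_{k+1}]`, and the positive times outside
  -- all of these, where the value is `x_∞`.
  have : (fun p : ℝ≥0 × Path S => p.2.xiLeft p.1) ⁻¹' V =
      ({⊥} : Set ℝ≥0) ×ˢ {e : Path S | e.jumpTime 0 ≤ (⊥ : ℝ≥0) ∧ e.state 0 ∈ V} ∪
      ((⋃ k, {p : ℝ≥0 × Path S | (p.2.jumpTime k < p.1 ∧ p.2.state k ∈ V) ∧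
        (p.1 : ℝ≥0∞) ≤ p.2.jumpTime (k + 1)}) ∪
      ({p : ℝ≥0 × Path S | p.1 ≠ 0} ∩ ((⋃ k, {p : ℝ≥0 × Path S | (p.2.jumpTime k < p.1 ∧
        p.2.state k ∈ (Set.univ : Set (Ext S))) ∧ (p.1 : ℝ≥0∞) ≤ p.2.jumpTime (k + 1)})ᶜ ∩
        {p : ℝ≥0 × Path S | Sum.inr () ∈ V}))) := by
    ext ⟨s, e⟩
    simp only [Set.mem_preimage, Set.mem_union, Set.mem_prod, Set.mem_singleton_iff,
      Set.mem_ofPred_eq, Set.mem_iUnion, Set.mem_inter_iff, Set.mem_compl_iff, Set.mem_univ,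
      and_true, bot_eq_zero]
    by_cases hs : s = 0
    · subst hs
      simp [xiLeft, jumpTime_zero, state]
    · by_cases hex : ∃ k, e.jumpTime k < s ∧ (s : ℝ≥0∞) ≤ e.jumpTime (k + 1)
      · have hex' := hex
        obtain ⟨k, h1, h2⟩ := hex
        rw [xiLeft_eq_state e h1 h2]
        simp only [hs, false_and, hex', not_true_eq_false, and_false, or_false, false_or]
        constructor
        · exact fun h => ⟨k, ⟨h1, h⟩, h2⟩
        · rintro ⟨j, ⟨h3, h⟩, h4⟩
          rwa [← xiLeft_eq_state e h1 h2, xiLeft_eq_state e h3 h4]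
      · rw [xiLeft_eq_inr e hs hex]
        simp only [hs, hex, false_and, false_or, not_false_eq_true, true_and, ne_eq]
        constructor
        · exact Or.inr
        · rintro (⟨j, ⟨h3, h⟩, h4⟩ | h)
          · exact absurd ⟨j, h3, h4⟩ hex
          · exact h
  rw [this]
  exact MeasurableSet.union h0 (MeasurableSet.union (MeasurableSet.iUnion fun k => hk k hV)
    (MeasurableSet.inter hpos
      (MeasurableSet.inter (MeasurableSet.iUnion fun k => hk k .univ).compl hC)))

lemma measurable_xi (t : ℝ≥0) : Measurable fun e : Path S => e.xi t := by
  intro V hV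
  have hk : ∀ (k : ℕ), MeasurableSet {e : Path S |
      e.jumpTime k ≤ t ∧ (t : ℝ≥0∞) < e.jumpTime (k + 1)} := fun k =>
    (measurableSet_le (measurable_jumpTime k) measurable_const).inter
      (measurableSet_lt measurable_const (measurable_jumpTime (k + 1)))
  have : (fun e : Path S => e.xi t) ⁻¹' V =
      (⋃ k, {e : Path S | e.jumpTime k ≤ t ∧ (t : ℝ≥0∞) < e.jumpTime (k + 1)} ∩
        (fun e : Path S => e.state k) ⁻¹' V) ∪
      ((⋃ k, {e : Path S | e.jumpTime k ≤ t ∧ (t : ℝ≥0∞) < e.jumpTime (k + 1)})ᶜ ∩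
        {_e : Path S | Sum.inr () ∈ V}) := by
    ext e
    simp only [Set.mem_preimage, Set.mem_union, Set.mem_ofPred_eq, Set.mem_iUnion,
      Set.mem_inter_iff, Set.mem_compl_iff]
    by_cases hex : ∃ k, e.jumpTime k ≤ t ∧ (t : ℝ≥0∞) < e.jumpTime (k + 1)
    · have hex' := hex
      obtain ⟨k, h1, h2⟩ := hex
      rw [xi_eq_state e h1 h2]
      simp only [hex', not_true_eq_false, false_and, or_false]
      constructor
      · exact fun h => ⟨k, ⟨h1, h2⟩, h⟩
      · rintro ⟨j, ⟨h3, h4⟩, h⟩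
        rwa [← xi_eq_state e h1 h2, xi_eq_state e h3 h4]
    · rw [xi_eq_inr e hex]
      simp only [hex, not_false_eq_true, true_and]
      constructor
      · exact Or.inr
      · rintro (⟨j, h, -⟩ | h)
        · exact absurd ⟨j, h⟩ hex
        · exact h
  rw [this]
  exact (MeasurableSet.iUnion fun k => (hk k).inter (measurable_state k hV)).union
    ((MeasurableSet.iUnion hk).compl.inter (.const _))

lemma measurable_init : Measurable (init : Path S → S) :=
  measurable_fst.comp measurable_subtype_coe

end Predictable

end Path

/-! ### Integrals against the jump measure. -/

namespace Path

variable {S : Type*} [MeasurableSpace S]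

/-- Restricting to positive times removes the atom at `T_0 = 0`, whence the shift of the index. -/
lemma setLIntegral_jumpMeasure [MeasurableSingletonClass S] (e : Path S) (f : ℝ≥0 × S → ℝ≥0∞) :
    ∫⁻ z in Set.Ioi 0 ×ˢ Set.univ, f z ∂e.jumpMeasure =
      ∑' k, Sum.elim (fun y => f ((e.jumpTime (k + 1)).toNNReal, y)) (fun _ => 0)
        (e.state (k + 1)) := by
  have hm : MeasurableSet (Set.Ioi (0 : ℝ≥0) ×ˢ (Set.univ : Set S)) :=
    measurableSet_Ioi.prod .univ
  rw [jumpMeasure, Measure.restrict_sum _ hm, lintegral_sum_measure,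
    tsum_eq_zero_add' ENNReal.summable]
  have h0 : ∀ k, ∫⁻ z in Set.Ioi 0 ×ˢ Set.univ, f z ∂(Sum.elim
      (fun y => Measure.dirac ((e.jumpTime k).toNNReal, y)) (fun _ => 0) (e.state k) :
        Measure (ℝ≥0 × S)) =
      if 0 < e.jumpTime k then Sum.elim (fun y => f ((e.jumpTime k).toNNReal, y)) (fun _ => 0)
        (e.state k) else 0 := by
    classical
    intro k
    rcases hs : e.state k with y | u
    · have ht := e.jumpTime_ne_top hs
      rw [Sum.elim_inl, Sum.elim_inl, setLIntegral_dirac]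
      have : ((e.jumpTime k).toNNReal, y) ∈ Set.Ioi (0 : ℝ≥0) ×ˢ (Set.univ : Set S) ↔
          0 < e.jumpTime k := by
        simp [ENNReal.toNNReal_pos_iff, ht.lt_top]
      simp only [this]
    · simp
  rw [h0 0, if_neg (by simp [jumpTime_zero]), zero_add]
  congr 1
  ext k
  rw [h0 (k + 1), if_pos (e.jumpTime_pos k)]

end Path

/-! ### Jump rates and the compensator identity. -/

namespace Model

variable {S A : Type*} [MeasurableSpace S] [MeasurableSpace A] (M : Model S A)

lemma qStar_lt_top (x : S) : M.qStar x < ∞ := M.stable x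

variable {M}

lemma q_compl {x : S} {a : A} (ha : a ∈ M.adm x) {D : Set S} (hD : MeasurableSet D) :
    M.q x a Dᶜ = -M.q x a D := by
  have h := VectorMeasure.of_add_of_sdiff hD MeasurableSet.univ (Set.subset_univ D)
    (v := M.q x a)
  rw [M.q_univ x a ha, ← Set.compl_eq_univ_sdiff] at h
  linarith

lemma q_nonpos {x : S} {a : A} (ha : a ∈ M.adm x) {D : Set S} (hD : MeasurableSet D) (hx : x ∈ D) :
    M.q x a D ≤ 0 := by
  have := M.q_nonneg x a ha Dᶜ hD.compl (by simpa using hx)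
  rw [q_compl ha hD] at this
  linarith

section Rates

variable [MeasurableSingletonClass S] {x : S} {a : A}

lemma jumpRate_of_notMem (ha : a ∈ M.adm x) {D : Set S} (hD : MeasurableSet D) (hx : x ∉ D) :
    M.jumpRate (Sum.inl x) (Sum.inl a) D = ENNReal.ofReal (M.q x a D) := by
  rw [M.jumpRate_apply ha hD, Set.sdiff_singleton_eq_self hx]

lemma jumpRate_compl (ha : a ∈ M.adm x) {D : Set S} (hD : MeasurableSet D) (hx : x ∈ D) :
    M.jumpRate (Sum.inl x) (Sum.inl a) Dᶜ = ENNReal.ofReal (-M.q x a D) := by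
  rw [jumpRate_of_notMem ha hD.compl (by simpa using hx), q_compl ha hD]

lemma jumpRate_singleton : M.jumpRate (Sum.inl x) (Sum.inl a) {x} = 0 := by
  simp [jumpRate]

lemma jumpRate_univ (ha : a ∈ M.adm x) :
    M.jumpRate (Sum.inl x) (Sum.inl a) Set.univ = ENNReal.ofReal (-M.q x a {x}) := by
  rw [← jumpRate_compl ha (measurableSet_singleton x) rfl,
    ← measure_add_measure_compl (measurableSet_singleton x), jumpRate_singleton, zero_add]

lemma jumpRate_univ_le (ha : a ∈ M.adm x) :
    M.jumpRate (Sum.inl x) (Sum.inl a) Set.univ ≤ M.qStar x := by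
  rw [jumpRate_univ ha]
  refine le_trans ?_ (le_iSup₂ (f := fun a (_ : a ∈ M.adm x) => ‖M.q x a {x}‖ₑ) a ha)
  rw [← ofReal_norm, Real.norm_eq_abs]
  exact ENNReal.ofReal_le_ofReal (neg_le_abs _)

lemma abs_q_le (ha : a ∈ M.adm x) {D : Set S} (hD : MeasurableSet D) :
    |M.q x a D| ≤ (M.qStar x).toReal := by
  have key : ∀ E : Set S, M.jumpRate (Sum.inl x) (Sum.inl a) E ≤ M.qStar x := fun E =>
    (measure_mono (Set.subset_univ E)).trans (jumpRate_univ_le ha)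
  by_cases hx : x ∈ D
  · rw [abs_of_nonpos (q_nonpos ha hD hx)]
    refine (ENNReal.ofReal_le_iff_le_toReal (M.qStar_lt_top x).ne).1 ?_
    rw [← jumpRate_compl ha hD hx]
    exact key _
  · rw [abs_of_nonneg (M.q_nonneg x a ha D hD hx)]
    refine (ENNReal.ofReal_le_iff_le_toReal (M.qStar_lt_top x).ne).1 ?_
    rw [← jumpRate_of_notMem ha hD hx]
    exact key _

instance (z : Ext S) (c : Ext A) : IsFiniteMeasure (M.jumpRate z c) := by
  rcases z with x | u <;> rcases c with a | u <;> simp only [jumpRate] <;> infer_instance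

/-- The only negative mass of `q(·|x,a)` sits at `x`. Splitting it off reduces the signed integral
in the drift condition to an integral against a positive measure. -/
lemma q_eq_toSignedMeasure_add_dirac (ha : a ∈ M.adm x) :
    M.q x a = (M.jumpRate (Sum.inl x) (Sum.inl a)).toSignedMeasure +
      VectorMeasure.dirac x (M.q x a {x}) := by
  ext D hD
  have hpos : 0 ≤ M.q x a (D \ {x}) :=
    M.q_nonneg x a ha _ (hD.diff (measurableSet_singleton x)) (by simp)
  have h1 : (M.jumpRate (Sum.inl x) (Sum.inl a)).real D = M.q x a (D \ {x}) := by
    rw [Measure.real, M.jumpRate_apply ha hD, ENNReal.toReal_ofReal hpos]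
  rw [add_apply, Measure.toSignedMeasure_apply_measurable hD, h1]
  by_cases hx : x ∈ D
  · rw [VectorMeasure.dirac_apply_of_mem hD hx, add_comm]
    exact (VectorMeasure.of_add_of_sdiff (measurableSet_singleton x) hD
      (Set.singleton_subset_iff.2 hx)).symm
  · rw [VectorMeasure.dirac_apply_of_notMem hx, Set.sdiff_singleton_eq_self hx, add_zero]

/-- The drift inequality in terms of the nonnegative jump rates. -/
lemma lintegral_jumpRate_le [TopologicalSpace S] {w : S → ℝ} {ρ b : ℝ} {L : ℕ → Set S}
    (hA : M.Nonexplosion w ρ b L) (ha : a ∈ M.adm x) :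
    ∫⁻ y, ENNReal.ofReal (w y) ∂M.jumpRate (Sum.inl x) (Sum.inl a) ≤
      ∫⁻ _, ENNReal.ofReal (w x) ∂M.jumpRate (Sum.inl x) (Sum.inl a) +
        (ENNReal.ofReal ρ * ENNReal.ofReal (w x) + ENNReal.ofReal b) := by
  have hw : ∀ y, 0 ≤ w y := fun y => zero_le_one.trans (hA.one_le y)
  have hle : M.jumpRate (Sum.inl x) (Sum.inl a) ≤ (M.q x a).variation := by
    rw [← SignedMeasure.totalVariation_eq_variation, SignedMeasure.totalVariation, jumpRate]
    exact Measure.restrict_le_self.trans (Measure.le_add_right le_rfl)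
  have hint : Integrable w (M.jumpRate (Sum.inl x) (Sum.inl a)) :=
    (hA.integrable x a ha).mono_measure hle
  have hint' : (M.jumpRate (Sum.inl x) (Sum.inl a)).toSignedMeasure.Integrable w := by
    rwa [VectorMeasure.Integrable, Measure.variation_toSignedMeasure]
  have hintd : (VectorMeasure.dirac x (M.q x a {x})).Integrable w := by
    rw [VectorMeasure.Integrable, VectorMeasure.variation_dirac]
    exact (integrable_dirac (by simp)).smul_measure (by simp)
  have hsplit : ∫ᵛ y, w y ∂•(M.q x a) =
      ∫ y, w y ∂M.jumpRate (Sum.inl x) (Sum.inl a) + w x * M.q x a {x} := by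
    -- Commutativity of real multiplication lets the pairing be flipped into the form required by
    -- `VectorMeasure.integral_toSignedMeasure`.
    have hflip : (ContinuousLinearMap.lsmul ℝ ℝ : ℝ →L[ℝ] ℝ →L[ℝ] ℝ) =
        (ContinuousLinearMap.lsmul ℝ ℝ : ℝ →L[ℝ] ℝ →L[ℝ] ℝ).flip := by
      ext
      simp
    rw [q_eq_toSignedMeasure_add_dirac ha, VectorMeasure.integral_add_vectorMeasure hint' hintd,
      VectorMeasure.integral_dirac, hflip, VectorMeasure.integral_toSignedMeasure,
      ← q_eq_toSignedMeasure_add_dirac ha]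
    simp [mul_comm]
  have hdrift := hA.drift x a ha
  rw [hsplit] at hdrift
  -- The mass at `x` is minus the total jump rate, so `w x * q {x}` moves to the right-hand side as
  -- a nonnegative term, the integral of the constant `w x` against the jump rates.
  have hq : 0 ≤ -M.q x a {x} :=
    neg_nonneg.2 (q_nonpos ha (measurableSet_singleton x) rfl)
  rw [← ofReal_integral_eq_lintegral_ofReal hint (ae_of_all _ hw), lintegral_const,
    jumpRate_univ ha, ← ENNReal.ofReal_mul (hw x), ← ENNReal.ofReal_mul hA.rho_nonneg,
    ← ENNReal.ofReal_add (mul_nonneg hA.rho_nonneg (hw x)) hA.b_nonneg,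
    ← ENNReal.ofReal_add (mul_nonneg (hw x) hq)
      (add_nonneg (mul_nonneg hA.rho_nonneg (hw x)) hA.b_nonneg)]
  exact ENNReal.ofReal_le_ofReal (by linarith)

end Rates

lemma measurableSet_admExt (z : Ext S) : MeasurableSet (M.admExt z) := by
  rcases z with x | u
  · exact measurableSet_inl_image.2 (measurable_prodMk_left M.measurableSet_graph)
  · have : M.admExt (Sum.inr u) = Set.range Sum.inr := by
      ext c
      exact ⟨fun h => ⟨(), h.symm⟩, fun ⟨_, h⟩ => h.symm⟩
    rw [this]
    exact measurableSet_range_inr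

lemma Policy.isProbabilityMeasure (π : M.Policy) (p : ℝ≥0 × Path S) :
    IsProbabilityMeasure (π.kernel p) :=
  π.isMarkovKernel.isProbabilityMeasure p

lemma Policy.ae_mem_admExt (π : M.Policy) (p : ℝ≥0 × Path S) :
    ∀ᵐ a ∂π.kernel p, a ∈ M.admExt (p.2.xiLeft p.1) := by
  have := π.isProbabilityMeasure p
  exact (mem_ae_iff_prob_eq_one (measurableSet_admExt _)).2 (π.kernel_adm p.1 p.2)

/-- The expected intensity `∫ π(da|e,t) ∫ F(ξ_{t-}, y) q(dy \ {ξ_{t-}}|ξ_{t-}, a)`. -/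
noncomputable def Policy.rate (π : M.Policy) (F : Ext S × Ext S → ℝ≥0∞) (p : ℝ≥0 × Path S) :
    ℝ≥0∞ :=
  ∫⁻ a, ∫⁻ y, F (p.2.xiLeft p.1, Sum.inl y) ∂M.jumpRate (p.2.xiLeft p.1) a ∂π.kernel p

/-- Only the constant `C` has to be measurable in the action for the integral to split, so no
measurability of `M.jumpRate` in the action is needed. -/
lemma Policy.rate_le_add (π : M.Policy) {F G : Ext S × Ext S → ℝ≥0∞} {p : ℝ≥0 × Path S}
    {C : ℝ≥0∞} (h : ∀ a ∈ M.admExt (p.2.xiLeft p.1),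
      ∫⁻ y, F (p.2.xiLeft p.1, Sum.inl y) ∂M.jumpRate (p.2.xiLeft p.1) a ≤
        ∫⁻ y, G (p.2.xiLeft p.1, Sum.inl y) ∂M.jumpRate (p.2.xiLeft p.1) a + C) :
    π.rate F p ≤ π.rate G p + C := by
  have := π.isProbabilityMeasure p
  calc π.rate F p ≤ ∫⁻ a, (∫⁻ y, G (p.2.xiLeft p.1, Sum.inl y)
        ∂M.jumpRate (p.2.xiLeft p.1) a + C) ∂π.kernel p :=
        lintegral_mono_ae ((π.ae_mem_admExt p).mono h)
    _ = π.rate G p + C := by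
      rw [lintegral_add_right _ measurable_const]
      simp [Policy.rate]

lemma Policy.rate_le (π : M.Policy) {F : Ext S × Ext S → ℝ≥0∞} {p : ℝ≥0 × Path S}
    {C : ℝ≥0∞} (h : ∀ a ∈ M.admExt (p.2.xiLeft p.1),
      ∫⁻ y, F (p.2.xiLeft p.1, Sum.inl y) ∂M.jumpRate (p.2.xiLeft p.1) a ≤ C) :
    π.rate F p ≤ C := by
  have := π.isProbabilityMeasure p
  refine (lintegral_mono_ae ((π.ae_mem_admExt p).mono h)).trans ?_
  simp

/-- If `F(x, ·) ≤ c` then the intensity is at most `c q*(x)` when `ξ_{t-} = x`. -/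
lemma Policy.rate_le_mul_qStar [MeasurableSingletonClass S] (π : M.Policy)
    {F : Ext S × Ext S → ℝ≥0∞} {p : ℝ≥0 × Path S} {c C : ℝ≥0∞}
    (hF : ∀ y, F (p.2.xiLeft p.1, Sum.inl y) ≤ c)
    (hC : ∀ x, p.2.xiLeft p.1 = Sum.inl x → M.qStar x ≤ C) :
    π.rate F p ≤ c * C := by
  refine π.rate_le fun a ha => ?_
  refine (lintegral_mono hF).trans ?_
  rw [lintegral_const]
  gcongr
  generalize p.2.xiLeft p.1 = z at ha hC
  rcases z with x | u
  · obtain ⟨a, ha, rfl⟩ := ha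
    exact (jumpRate_univ_le ha).trans (hC x rfl)
  · simp [jumpRate]

/-- The compensator identity for the predictable integrands `1_Z(t, e) F(ξ_{t-}, y)`. -/
lemma IsLaw.lintegral_tsum_jumps [MeasurableSingletonClass S] {π : M.Policy} {γ : Measure S}
    {P : Measure (Path S)} (hP : IsLaw π γ P) {Z : Set (ℝ≥0 × Path S)}
    (hZ : MeasurableSet[(Path.filtration S).predictable] Z) {F : Ext S × Ext S → ℝ≥0∞}
    (hF : Measurable F) :
    ∫⁻ e, ∑' k, {e : Path S | e.jumpTime (k + 1) ≠ ∞ ∧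
        ((e.jumpTime (k + 1)).toNNReal, e) ∈ Z}.indicator
          (fun e => F (e.state k, e.state (k + 1))) e ∂P =
      ∫⁻ e, ∫⁻ t in Set.Ioi (0 : ℝ),
        Z.indicator (π.rate F) (t.toNNReal, e) ∂volume ∂P := by
  classical
  let Y : (ℝ≥0 × Path S) × S → ℝ≥0∞ := fun p =>
    Z.indicator (fun _ => 1) p.1 * F (p.1.2.xiLeft p.1.1, Sum.inl p.2)
  have hY : Measurable[(Path.filtration S).predictable.prod inferInstance] Y := by
    let _ : MeasurableSpace (ℝ≥0 × Path S) := (Path.filtration S).predictable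
    have h1 : Measurable fun p : (ℝ≥0 × Path S) × S => Z.indicator (fun _ => (1 : ℝ≥0∞)) p.1 :=
      (measurable_const.indicator hZ).comp measurable_fst
    have h2 : Measurable fun p : (ℝ≥0 × Path S) × S => p.1.2.xiLeft p.1.1 :=
      Path.measurable_xiLeft_predictable.comp measurable_fst
    exact h1.mul (hF.comp (h2.prodMk (measurable_inl.comp measurable_snd)))
  have h := hP.compensator Y hY
  convert h using 1
  · congr 1
    ext e
    rw [Path.setLIntegral_jumpMeasure]
    congr 1
    ext k
    rcases hs : e.state (k + 1) with y | u
    · have ht := e.jumpTime_ne_top hs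
      -- The left limit at an epoch is the state before that jump, so `Y` sees the transition `(X_k,
      -- X_{k+1})`.
      have hxi : e.xiLeft (e.jumpTime (k + 1)).toNNReal = e.state k := by
        refine e.xiLeft_eq_state ?_ ?_ <;> rw [ENNReal.coe_toNNReal ht]
        exact e.jumpTime_lt_succ (ne_top_of_le_ne_top ht (e.jumpTime_mono k.le_succ))
      by_cases hz : ((e.jumpTime (k + 1)).toNNReal, e) ∈ Z
      · simp [Set.indicator, ht, hz, Y, hxi, hs]
      · simp [Set.indicator, ht, hz, Y]
    · have ht : e.jumpTime (k + 1) = ∞ := (e.jumpTime_eq_top_iff _).2 hs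
      simp [Set.indicator, ht]
  · congr 1
    ext e
    congr 1
    ext t
    by_cases hz : (t.toNNReal, e) ∈ Z
    · simp [hz, Y, Policy.rate]
    · simp [hz, Y]

end Model

/-! ### The jump process stopped on leaving a set. -/

namespace Path

variable {S : Type*}

/-- The event that the `k`-th jump epoch lies in `I` and all earlier states lie in `V`. -/
def live (I : Set ℝ≥0) (V : Set (Ext S)) (k : ℕ) : Set (Path S) :=
  {e | e.jumpTime k ≠ ∞ ∧ (e.jumpTime k).toNNReal ∈ I ∧ ∀ j < k, e.state j ∈ V}

open Classical in
/-- The value of `f` along the jump process after its jumps with epochs in `I`, stopped at the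
first exit from `V` and at the `N`-th jump. -/
noncomputable def stopped (f : Ext S → ℝ≥0∞) (I : Set ℝ≥0) (V : Set (Ext S)) :
    ℕ → Path S → ℝ≥0∞
  | 0, e => f (e.state 0)
  | N + 1, e => if e ∈ live I V (N + 1) then f (e.state (N + 1)) else stopped f I V N e

/-- The times `s` up to the first exit from `V` and the `N`-th jump. -/
def beforeExit (V : Set (Ext S)) (N : ℕ) : Set (ℝ≥0 × Path S) :=
  {p | p.1 ≤ p.2.jumpTime N ∧ ∀ j, p.2.jumpTime j < p.1 → p.2.state j ∈ V}

section Pathwise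

variable {I : Set ℝ≥0} {V : Set (Ext S)} {f : Ext S → ℝ≥0∞} {e : Path S}

lemma live_antitone (hI : IsLowerSet I) : Antitone (live I V : ℕ → Set (Path S)) :=
  fun _ _ hjk e he =>
    have hle := e.jumpTime_mono hjk
    ⟨ne_top_of_le_ne_top he.1 hle, hI (ENNReal.toNNReal_mono he.1 hle) he.2.1,
      fun i hi => he.2.2 i (hi.trans_le hjk)⟩

lemma stopped_of_mem_live {N : ℕ} (h : e ∈ live I V N) : stopped f I V N e = f (e.state N) := by
  cases N with
  | zero => rfl
  | succ N => rw [stopped, if_pos h]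

/-- The events `live` decrease, so after the first failure the stopped value is frozen. -/
lemma stopped_eq (hI : IsLowerSet I) {k N : ℕ} (hkN : k ≤ N) (h₁ : e ∈ live I V k)
    (h₂ : e ∉ live I V (k + 1)) : stopped f I V N e = f (e.state k) := by
  induction N, hkN using Nat.le_induction with
  | base => exact stopped_of_mem_live h₁
  | succ N hN ih => rw [stopped, if_neg fun h => h₂ (live_antitone hI (by lia) h), ih]

/-- Telescoping of the increments of `f` along the stopped jump process. -/
lemma stopped_add_sum (hI : IsLowerSet I) {F G : Ext S × Ext S → ℝ≥0∞}
    (h : ∀ z z', f z + F (z, z') = f z' + G (z, z')) (N : ℕ) (e : Path S) :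
    stopped f I V N e + ∑ k ∈ Finset.range N,
        (live I V (k + 1)).indicator (fun e => G (e.state k, e.state (k + 1))) e =
      f (e.state 0) + ∑ k ∈ Finset.range N,
        (live I V (k + 1)).indicator (fun e => F (e.state k, e.state (k + 1))) e := by
  induction N with
  | zero => simp [stopped]
  | succ N ih =>
    rw [Finset.sum_range_succ, Finset.sum_range_succ]
    by_cases he : e ∈ live I V (N + 1)
    · rw [stopped_of_mem_live (live_antitone hI N.le_succ he)] at ih
      rw [stopped_of_mem_live he, Set.indicator_of_mem he, Set.indicator_of_mem he, ← add_assoc,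
        ← add_assoc, ← ih, add_right_comm, ← h, add_right_comm]
    · rw [Set.indicator_of_notMem he, Set.indicator_of_notMem he, add_zero, add_zero, stopped,
        if_neg he, ih]

/-- The epochs strictly before `T_{k+1}` are `T_0, …, T_k`. The strict inequality in `beforeExit`
leaves `X_{k+1}` free, so the jump that exits `V` is still counted. -/
lemma mem_beforeExit_iff {k N : ℕ} (ht : e.jumpTime (k + 1) ≠ ∞) :
    ((e.jumpTime (k + 1)).toNNReal ∈ I ∧ ((e.jumpTime (k + 1)).toNNReal, e) ∈ beforeExit V N) ↔
      e ∈ live I V (k + 1) ∧ k < N := by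
  simp only [beforeExit, live, Set.mem_ofPred_eq, ENNReal.coe_toNNReal ht]
  constructor
  · rintro ⟨h1, h2, h3⟩
    refine ⟨⟨ht, h1, fun j hj => h3 j ?_⟩, e.le_of_jumpTime_le ht h2⟩
    have hk := ne_top_of_le_ne_top ht (e.jumpTime_mono k.le_succ)
    exact (e.jumpTime_mono (Nat.lt_succ_iff.1 hj)).trans_lt (e.jumpTime_lt_succ hk)
  · rintro ⟨⟨-, h1, h2⟩, h3⟩
    exact ⟨h1, e.jumpTime_mono h3, fun j hj => h2 j (e.jumpTime_mono.reflect_lt hj)⟩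

lemma xiLeft_mem_of_beforeExit {s : ℝ≥0} (hs : s ≠ 0) {N : ℕ} (h : (s, e) ∈ beforeExit V N) :
    e.xiLeft s ∈ V ∨ e.xiLeft s = Sum.inr () := by
  by_cases hex : ∃ k, e.jumpTime k < s ∧ (s : ℝ≥0∞) ≤ e.jumpTime (k + 1)
  · obtain ⟨k, h1, h2⟩ := hex
    rw [e.xiLeft_eq_state h1 h2]
    exact Or.inl (h.2 k h1)
  · exact Or.inr (e.xiLeft_eq_inr hs hex)

/-- The left limit at `s` is the state after the jumps strictly before `s`, hence the half-open
interval. This is what closes the Grönwall inequality for `w(ξ_{s-})`. -/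
lemma le_stopped_Iio {s : ℝ≥0} (hs : s ≠ 0) (hf : f (Sum.inr ()) = 0) {N : ℕ}
    (h : (s, e) ∈ beforeExit V N) : f (e.xiLeft s) ≤ stopped f (Set.Iio s) V N e := by
  by_cases hex : ∃ k, e.jumpTime k < s ∧ (s : ℝ≥0∞) ≤ e.jumpTime (k + 1)
  · obtain ⟨k, h1, h2⟩ := hex
    have hk := h1.ne_top
    have hkN : k < N := e.jumpTime_mono.reflect_lt (h1.trans_le h.1)
    rw [e.xiLeft_eq_state h1 h2, stopped_eq (isLowerSet_Iio s) hkN.le (k := k)]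
    · refine ⟨hk, ?_, fun j hj => h.2 j ((e.jumpTime_mono hj.le).trans_lt h1)⟩
      rwa [Set.mem_Iio, ← ENNReal.coe_lt_coe, ENNReal.coe_toNNReal hk]
    · rintro ⟨ht, hI, -⟩
      rw [Set.mem_Iio, ← ENNReal.coe_lt_coe, ENNReal.coe_toNNReal ht] at hI
      exact h2.not_gt hI
  · rw [e.xiLeft_eq_inr hs hex, hf]
    exact zero_le

lemma toNNReal_mem_Iic_iff {a : ℝ≥0∞} {t : ℝ≥0} : (a ≠ ∞ ∧ a.toNNReal ∈ Set.Iic t) ↔ a ≤ t := by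
  constructor
  · rintro ⟨h1, h2⟩
    rwa [Set.mem_Iic, ← ENNReal.coe_le_coe, ENNReal.coe_toNNReal h1] at h2
  · intro h
    have h1 : a ≠ ∞ := ne_top_of_le_ne_top ENNReal.coe_ne_top h
    refine ⟨h1, ?_⟩
    rwa [Set.mem_Iic, ← ENNReal.coe_le_coe, ENNReal.coe_toNNReal h1]

lemma mem_live_Iic_iff {t : ℝ≥0} {k : ℕ} :
    e ∈ live (Set.Iic t) V k ↔ e.jumpTime k ≤ t ∧ ∀ j < k, e.state j ∈ V := by
  rw [← toNNReal_mem_Iic_iff, and_assoc]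
  rfl

/-- If explosion occurs by time `t`, then either `N` jumps occur before the exit from
`{f ≤ c}`, or the stopped process exceeds `c`. -/
lemma mem_live_or_lt_stopped {t : ℝ≥0} (ht : e.explosionTime ≤ t) (c : ℝ≥0∞) (N : ℕ) :
    e ∈ live (Set.Iic t) {z | f z ≤ c} N ∨ c < stopped f (Set.Iic t) {z | f z ≤ c} N e := by
  classical
  by_cases hN : e ∈ live (Set.Iic t) {z | f z ≤ c} N
  · exact Or.inl hN
  · right
    have hT : ∀ k, e.jumpTime k ≤ t := fun k => (le_iSup e.jumpTime k).trans ht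
    -- All epochs are at most `t`, so the first failure of `live` can only come from a state with `f
    -- > c`, and this is the state at which the process is frozen.
    have hex : ∃ j, e ∉ live (Set.Iic t) {z | f z ≤ c} (j + 1) := by
      cases N with
      | zero => exact absurd (mem_live_Iic_iff.2 ⟨hT 0, by simp⟩) hN
      | succ N => exact ⟨N, hN⟩
    have hmin : e ∈ live (Set.Iic t) {z | f z ≤ c} (Nat.find hex) := by
      rcases hk : Nat.find hex with _ | k
      · exact mem_live_Iic_iff.2 ⟨hT 0, by simp⟩
      · exact not_not.1 (Nat.find_min hex (hk ▸ Nat.lt_succ_self k))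
    have hle : Nat.find hex ≤ N := by
      by_contra! hlt
      exact hN (live_antitone (isLowerSet_Iic t) hlt.le hmin)
    rw [stopped_eq (isLowerSet_Iic t) hle hmin (Nat.find_spec hex)]
    by_contra! hc
    refine Nat.find_spec hex (mem_live_Iic_iff.2 ⟨hT _, fun j hj => ?_⟩)
    rcases Nat.lt_succ_iff_lt_or_eq.1 hj with hj | rfl
    · exact hmin.2.2 j hj
    · exact hc

end Pathwise

section Measurability

variable [MeasurableSpace S] {I : Set ℝ≥0} {V : Set (Ext S)} {f : Ext S → ℝ≥0∞}

lemma measurableSet_live (hI : MeasurableSet I) (hV : MeasurableSet V) (k : ℕ) :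
    MeasurableSet (live I V k) := by
  have h1 : MeasurableSet {e : Path S | e.jumpTime k ≠ ∞} :=
    measurable_jumpTime k (measurableSet_singleton ∞).compl
  have h2 : MeasurableSet {e : Path S | (e.jumpTime k).toNNReal ∈ I} :=
    (measurable_jumpTime k).ennreal_toNNReal hI
  have h3 : MeasurableSet {e : Path S | ∀ j < k, e.state j ∈ V} := by
    have : {e : Path S | ∀ j < k, e.state j ∈ V} =
        ⋂ j, ⋂ (_ : j < k), (fun e : Path S => e.state j) ⁻¹' V := by
      ext
      simp
    rw [this]
    exact MeasurableSet.iInter fun j => MeasurableSet.iInter fun _ => measurable_state j hV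
  exact h1.inter (h2.inter h3)

lemma measurable_stopped (hI : MeasurableSet I) (hV : MeasurableSet V) (hf : Measurable f)
    (N : ℕ) : Measurable (stopped f I V N) := by
  induction N with
  | zero => exact hf.comp (measurable_state 0)
  | succ N ih =>
    classical
    have : stopped f I V (N + 1) =
        (live I V (N + 1)).piecewise (fun e => f (e.state (N + 1))) (stopped f I V N) := by
      ext e
      simp only [stopped, Set.piecewise]
    rw [this]
    exact Measurable.piecewise (measurableSet_live hI hV _)
      (hf.comp (measurable_state (N + 1))) ih

lemma measurableSet_beforeExit (hV : MeasurableSet V) (N : ℕ) :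
    MeasurableSet[(filtration S).predictable] (beforeExit V N) := by
  have : beforeExit V N = {p : ℝ≥0 × Path S | (p.1 : ℝ≥0∞) ≤ p.2.jumpTime N} ∩
      ⋂ j, {p : ℝ≥0 × Path S | p.2.jumpTime j < p.1 ∧ p.2.state j ∈ Vᶜ}ᶜ := by
    ext p
    simp [beforeExit]
  rw [this]
  exact MeasurableSet.inter (measurableSet_predictable_le_jumpTime N)
    (MeasurableSet.iInter fun j => (measurableSet_predictable_jumpTime_lt j hV.compl).compl)

end Measurability

end Path

/-! ### Dynkin's formula. -/

namespace Model

open CTMDP.Path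

variable {S A : Type*} [MeasurableSpace S] [MeasurableSpace A] {M : Model S A}
  {π : M.Policy} {x : S} {P : Measure (Path S)}

lemma IsLaw.lintegral_state_zero {f : Ext S → ℝ≥0∞} (hP : IsLaw π (Measure.dirac x) P)
    (hf : Measurable f) : ∫⁻ e, f (e.state 0) ∂P = f (Sum.inl x) := by
  have : ∫⁻ y, f (Sum.inl y) ∂(P.map Path.init) = ∫⁻ e, f (e.state 0) ∂P :=
    lintegral_map (hf.comp measurable_inl) measurable_init
  rw [← this, hP.map_init]
  exact lintegral_dirac' _ (hf.comp measurable_inl)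

section Dynkin

variable [MeasurableSingletonClass S] {γ : Measure S} {I : Set ℝ≥0} {V : Set (Ext S)}

/-- Stopping is encoded in the predictable set `Prod.fst ⁻¹' I ∩ beforeExit V N`, which selects
exactly the first `N` jumps that are live. -/
lemma IsLaw.lintegral_sum_live (hP : IsLaw π γ P) (hI : MeasurableSet I) (hV : MeasurableSet V)
    {F : Ext S × Ext S → ℝ≥0∞} (hF : Measurable F) (N : ℕ) :
    ∫⁻ e, ∑ k ∈ Finset.range N,
        (live I V (k + 1)).indicator (fun e => F (e.state k, e.state (k + 1))) e ∂P =
      ∫⁻ e, ∫⁻ t in Set.Ioi (0 : ℝ),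
        (Prod.fst ⁻¹' I ∩ beforeExit V N).indicator (π.rate F) (t.toNNReal, e) ∂volume ∂P := by
  rw [← hP.lintegral_tsum_jumps (MeasurableSet.inter (measurable_fst_predictable hI)
    (measurableSet_beforeExit hV N)) hF]
  congr 1
  ext e
  have key : ∀ k, e ∈ {e : Path S | e.jumpTime (k + 1) ≠ ∞ ∧
      ((e.jumpTime (k + 1)).toNNReal, e) ∈ Prod.fst ⁻¹' I ∩ beforeExit V N} ↔
      e ∈ live I V (k + 1) ∧ k < N := by
    intro k
    constructor
    · exact fun h => (mem_beforeExit_iff h.1).1 h.2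
    · exact fun h => ⟨h.1.1, (mem_beforeExit_iff h.1.1).2 h⟩
  rw [tsum_eq_sum (s := Finset.range N)]
  · refine Finset.sum_congr rfl fun k hk => ?_
    by_cases he : e ∈ live I V (k + 1)
    · rw [Set.indicator_of_mem he, Set.indicator_of_mem
        ((key k).2 ⟨he, Finset.mem_range.1 hk⟩)]
    · rw [Set.indicator_of_notMem he, Set.indicator_of_notMem fun h => he ((key k).1 h).1]
  · intro k hk
    exact Set.indicator_of_notMem (fun h => hk (Finset.mem_range.2 ((key k).1 h).2)) _

/-- Dynkin's formula for the stopped jump process. -/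
lemma IsLaw.lintegral_stopped_add (hP : IsLaw π (Measure.dirac x) P) (hI : MeasurableSet I)
    (hIl : IsLowerSet I) (hV : MeasurableSet V) {f : Ext S → ℝ≥0∞} (hf : Measurable f)
    {F G : Ext S × Ext S → ℝ≥0∞} (hF : Measurable F) (hG : Measurable G)
    (h : ∀ z z', f z + F (z, z') = f z' + G (z, z')) (N : ℕ) :
    ∫⁻ e, stopped f I V N e ∂P + ∫⁻ e, ∫⁻ t in Set.Ioi (0 : ℝ),
        (Prod.fst ⁻¹' I ∩ beforeExit V N).indicator (π.rate G) (t.toNNReal, e) ∂volume ∂P =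
      f (Sum.inl x) + ∫⁻ e, ∫⁻ t in Set.Ioi (0 : ℝ),
        (Prod.fst ⁻¹' I ∩ beforeExit V N).indicator (π.rate F) (t.toNNReal, e) ∂volume ∂P := by
  rw [← hP.lintegral_sum_live hI hV hF, ← hP.lintegral_sum_live hI hV hG,
    ← hP.lintegral_state_zero hf, ← lintegral_add_left (measurable_stopped hI hV hf N),
    ← lintegral_add_left (f := fun e : Path S => f (e.state 0)) (hf.comp (measurable_state 0))]
  exact lintegral_congr fun e => stopped_add_sum hIl h N e

end Dynkin

/-- The integral over a bounded time interval of a rate bounded by `C`. -/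
lemma lintegral_indicator_le [IsProbabilityMeasure P] {Z : Set (ℝ≥0 × Path S)} {t : ℝ≥0}
    (hZ : ∀ p ∈ Z, p.1 ≤ t) {g : ℝ≥0 × Path S → ℝ≥0∞} {C : ℝ≥0∞}
    (hg : ∀ p ∈ Z, p.1 ≠ 0 → g p ≤ C) :
    ∫⁻ e, ∫⁻ s in Set.Ioi (0 : ℝ), Z.indicator g (s.toNNReal, e) ∂volume ∂P ≤ C * t := by
  have hin : ∀ e, ∫⁻ s in Set.Ioi (0 : ℝ), Z.indicator g (s.toNNReal, e) ∂volume ≤ C * t := by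
    intro e
    have hbound : ∀ s ∈ Set.Ioi (0 : ℝ), Z.indicator g (s.toNNReal, e) ≤
        (Set.Iic (t : ℝ)).indicator (fun _ => C) s := by
      intro s hs
      by_cases hz : (s.toNNReal, e) ∈ Z
      · have hst : s ∈ Set.Iic (t : ℝ) := Real.toNNReal_le_iff_le_coe.1 (hZ _ hz)
        rw [Set.indicator_of_mem hz, Set.indicator_of_mem hst]
        exact hg _ hz (Real.toNNReal_pos.2 hs).ne'
      · rw [Set.indicator_of_notMem hz]
        exact zero_le
    refine (setLIntegral_mono' measurableSet_Ioi hbound).trans ?_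
    rw [lintegral_indicator measurableSet_Iic, Measure.restrict_restrict measurableSet_Iic,
      lintegral_const, Measure.restrict_apply_univ, Set.inter_comm, Set.Ioi_inter_Iic,
      Real.volume_Ioc, sub_zero, ENNReal.ofReal_coe_nnreal]
  refine (lintegral_mono hin).trans ?_
  simp

end Model

/-! ### Grönwall's inequality. -/

/-- An integral form of Grönwall's inequality for bounded measurable functions. -/
lemma lintegral_le_gronwallBound {u : ℝ → ℝ≥0∞} (hu : Measurable u) {C : ℝ≥0∞} (hC : C ≠ ∞)
    (huC : ∀ s, 0 < s → u s ≤ C) {K ρ b : ℝ} (hK : 0 ≤ K) (hρ : 0 ≤ ρ) (hb : 0 ≤ b)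
    (h : ∀ s, 0 < s → u s ≤ ENNReal.ofReal K +
      ∫⁻ r in Set.Ioo 0 s, (ENNReal.ofReal ρ * u r + ENNReal.ofReal b)) {t : ℝ} (ht : 0 ≤ t) :
    ENNReal.ofReal K + ∫⁻ r in Set.Ioc 0 t, (ENNReal.ofReal ρ * u r + ENNReal.ofReal b) ≤
      ENNReal.ofReal (gronwallBound K ρ b t) := by
  let v : ℝ → ℝ := (Set.Ioi (0 : ℝ)).indicator fun r => ρ * (u r).toReal + b
  have hv0 : ∀ r, 0 ≤ v r := fun r => Set.indicator_nonneg (fun r _ => by positivity) r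
  have hvm : Measurable v :=
    ((hu.ennreal_toReal.const_mul ρ).add_const b).indicator measurableSet_Ioi
  have hvC : ∀ r, ‖v r‖ ≤ ρ * C.toReal + b := by
    intro r
    rw [Real.norm_of_nonneg (hv0 r)]
    by_cases hr : r ∈ Set.Ioi (0 : ℝ)
    · simp only [v, Set.indicator_of_mem hr]
      gcongr
      exact huC r hr
    · simp only [v, Set.indicator_of_notMem hr]
      positivity
  have hvi : ∀ a c, IntervalIntegrable v volume a c := fun a c =>
    (intervalIntegrable_const (c := ρ * C.toReal + b)).mono_fun hvm.aestronglyMeasurable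
      (ae_of_all _ fun r => (hvC r).trans (le_abs_self _))
  have hconv : ∀ s, 0 ≤ s → ENNReal.ofReal K +
      ∫⁻ r in Set.Ioc 0 s, (ENNReal.ofReal ρ * u r + ENNReal.ofReal b) =
      ENNReal.ofReal (K + ∫ r in (0 : ℝ)..s, v r) := by
    intro s hs
    rw [ENNReal.ofReal_add hK (intervalIntegral.integral_nonneg hs fun r _ => hv0 r),
      intervalIntegral.integral_of_le hs,
      ofReal_integral_eq_lintegral_ofReal (hvi 0 s).1 (ae_of_all _ hv0)]
    congr 1
    refine setLIntegral_congr_fun measurableSet_Ioc fun r hr => ?_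
    have hr' : r ∈ Set.Ioi (0 : ℝ) := hr.1
    simp only [v, Set.indicator_of_mem hr']
    rw [ENNReal.ofReal_add (by positivity) hb, ENNReal.ofReal_mul hρ,
      ENNReal.ofReal_toReal (ne_top_of_le_ne_top hC (huC r hr'))]
  let ψ : ℝ → ℝ := fun s => K + ∫ r in (0 : ℝ)..s, v r
  have hψc : Continuous ψ := continuous_const.add (intervalIntegral.continuous_primitive hvi 0)
  have hψ0 : ∀ s, 0 ≤ s → 0 ≤ ψ s := fun s hs =>
    add_nonneg hK (intervalIntegral.integral_nonneg hs fun r _ => hv0 r)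
  have hvψ : ∀ s, 0 ≤ s → v s ≤ ρ * ψ s + b := by
    intro s hs
    by_cases hs' : s ∈ Set.Ioi (0 : ℝ)
    · simp only [v, Set.indicator_of_mem hs']
      gcongr
      refine ENNReal.toReal_le_of_le_ofReal (hψ0 s hs) ?_
      rw [← hconv s hs, ← restrict_Ioo_eq_restrict_Ioc]
      exact h s hs'
    · simp only [v, Set.indicator_of_notMem hs']
      have := hψ0 s hs
      positivity
  have hχc : Continuous fun s => ρ * ψ s + b := (hψc.const_mul ρ).add_const b
  -- As `v` is merely measurable, `ψ` is continuous but need not be differentiable. A second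
  -- integration gives a differentiable `θ ≥ ψ` with `θ' = ρ ψ + b ≤ ρ θ + b`, to which the
  -- differential form applies.
  let θ : ℝ → ℝ := fun s => K + ∫ r in (0 : ℝ)..s, (ρ * ψ r + b)
  have hθd : ∀ s, HasDerivAt θ (ρ * ψ s + b) s := fun s =>
    (intervalIntegral.integral_hasDerivAt_right (hχc.intervalIntegrable _ _)
      hχc.stronglyMeasurable.stronglyMeasurableAtFilter hχc.continuousAt).const_add K
  have hψθ : ∀ s, 0 ≤ s → ψ s ≤ θ s := fun s hs =>
    add_le_add le_rfl (intervalIntegral.integral_mono_on hs (hvi 0 s)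
      (hχc.intervalIntegrable _ _) fun r hr => hvψ r hr.1)
  have hg := le_gronwallBound_of_liminf_deriv_right_le (f := θ) (f' := fun s => ρ * ψ s + b)
    (δ := K) (K := ρ) (ε := b) (a := 0) (b := t)
    (fun s _ => (hθd s).continuousAt.continuousWithinAt)
    (fun s _ r hr => ((hθd s).hasDerivWithinAt (s := Set.Ici s)).liminf_right_slope_le hr)
    (by simp [θ]) (fun s hs => by have := hψθ s hs.1; gcongr) t ⟨ht, le_rfl⟩
  rw [sub_zero] at hg
  rw [hconv t ht]
  exact ENNReal.ofReal_le_ofReal ((hψθ t ht).trans hg)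

/-! ### Lyapunov estimates, nonexplosion and the moment bound. -/

namespace Model

open CTMDP.Path

/-- The Lyapunov function as a function on the extended state space, equal to `0` at `x_∞`. -/
noncomputable def lyap {S : Type*} (w : S → ℝ) : Ext S → ℝ≥0∞ :=
  Sum.elim (fun y => ENNReal.ofReal (w y)) fun _ => 0

lemma measurable_lyap {S : Type*} [MeasurableSpace S] {w : S → ℝ} (hw : Measurable w) :
    Measurable (lyap w) :=
  (ENNReal.measurable_ofReal.comp hw).sumElim measurable_const

section Pathwise

variable {S : Type*} {w : S → ℝ}

lemma lyap_xiLeft_le {c : ℝ≥0∞} {N : ℕ} {p : ℝ≥0 × Path S}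
    (hp : p ∈ beforeExit {z | lyap w z ≤ c} N) (h0 : p.1 ≠ 0) : lyap w (p.2.xiLeft p.1) ≤ c := by
  rcases xiLeft_mem_of_beforeExit h0 hp with h | h
  · exact h
  · rw [h]
    exact zero_le

lemma exists_xi_eq_inl {e : Path S} (he : e.explosionTime = ∞) (t : ℝ≥0) :
    ∃ y, e.xi t = Sum.inl y := by
  obtain ⟨k, h1, h2⟩ := e.exists_jumpTime_le_lt (t := t) (by simp [he])
  rw [e.xi_eq_state h1 h2]
  exact e.exists_state_eq_inl (ne_top_of_le_ne_top ENNReal.coe_ne_top h1)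

/-- The stopped processes eventually agree with `f(ξ_t)`. -/
lemma lyap_xi_le_liminf (e : Path S) (t : ℝ≥0) :
    lyap w (e.xi t) ≤
      liminf (fun n : ℕ => stopped (lyap w) (Set.Iic t) {z | lyap w z ≤ (n : ℝ≥0)} n e) atTop := by
  by_cases hex : ∃ k, e.jumpTime k ≤ t ∧ (t : ℝ≥0∞) < e.jumpTime (k + 1)
  · obtain ⟨k, h1, h2⟩ := hex
    rw [e.xi_eq_state h1 h2]
    have hfin : ∀ z, lyap w z ≠ ∞ := by
      rintro (y | u) <;> simp [lyap]
    -- Only finitely many states precede the current one, so for large `n` neither the level `n` nor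
    -- the cap of `n` jumps stops the process by time `t`.
    obtain ⟨m, hm⟩ : ∃ m : ℕ, ∀ j < k, lyap w (e.state j) ≤ m := by
      obtain ⟨m, hm⟩ := ENNReal.exists_nat_gt (r := ∑ j ∈ Finset.range k, lyap w (e.state j))
        (ENNReal.sum_ne_top.2 fun j _ => hfin _)
      exact ⟨m, fun j hj => (Finset.single_le_sum (f := fun j => lyap w (e.state j))
        (fun _ _ => zero_le) (Finset.mem_range.2 hj)).trans hm.le⟩
    refine le_liminf_of_le (by isBoundedDefault) ?_
    filter_upwards [eventually_ge_atTop m, eventually_ge_atTop k] with n hmn hkn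
    rw [stopped_eq (isLowerSet_Iic t) hkn (mem_live_Iic_iff.2 ⟨h1, fun j hj => ?_⟩)
      fun h => (mem_live_Iic_iff.1 h).1.not_gt h2]
    exact (hm j hj).trans (by simpa using hmn)
  · rw [e.xi_eq_inr hex]
    exact zero_le

end Pathwise

variable {S A : Type*} [MeasurableSpace S] [MeasurableSpace A] {M : Model S A}

/-- Since `w` tends to infinity off the sets `L k`, a sublevel set of `w` lies inside some `L k`,
where `q*` is bounded. -/
lemma Nonexplosion.exists_qStar_le [TopologicalSpace S] {w : S → ℝ} {ρ b : ℝ} {L : ℕ → Set S}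
    (hA : M.Nonexplosion w ρ b L) (c : ℝ≥0) :
    ∃ C : ℝ≥0∞, C ≠ ∞ ∧ ∀ y, ENNReal.ofReal (w y) ≤ c → M.qStar y ≤ C := by
  obtain ⟨k, hk⟩ := (hA.tendsto_inf.eventually (lt_mem_nhds (ENNReal.coe_lt_top (r := c)))).exists
  refine ⟨⨆ x ∈ L k, M.qStar x, (hA.bounded k).ne, fun y hy => ?_⟩
  have hyL : y ∈ L k := by
    by_contra hyL
    exact (hk.trans_le (iInf₂_le y hyL)).not_ge hy
  exact le_iSup₂ (f := fun x (_ : x ∈ L k) => M.qStar x) y hyL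

lemma measurableSet_lyap_le [TopologicalSpace S] [OpensMeasurableSpace S] {w : S → ℝ}
    {ρ b : ℝ} {L : ℕ → Set S} (hA : M.Nonexplosion w ρ b L) (c : ℝ≥0∞) :
    MeasurableSet {z | lyap w z ≤ c} :=
  measurable_lyap hA.continuous.measurable measurableSet_Iic

lemma rate_le_of_beforeExit [MeasurableSingletonClass S] {π : M.Policy} {w : S → ℝ} {c : ℝ≥0}
    {C : ℝ≥0∞} (hC : ∀ y, ENNReal.ofReal (w y) ≤ c → M.qStar y ≤ C) {N : ℕ} {p : ℝ≥0 × Path S}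
    (hp : p ∈ beforeExit {z | lyap w z ≤ c} N) (h0 : p.1 ≠ 0) {F : Ext S × Ext S → ℝ≥0∞}
    {d : ℝ≥0∞} (hF : ∀ y, F (p.2.xiLeft p.1, Sum.inl y) ≤ d) : π.rate F p ≤ d * C := by
  refine π.rate_le_mul_qStar hF fun x hx => hC x ?_
  have := lyap_xiLeft_le hp h0
  rwa [hx] at this

section Lyapunov

variable [TopologicalSpace S] [MeasurableSingletonClass S] [OpensMeasurableSpace S]
  {w : S → ℝ} {ρ b : ℝ} {L : ℕ → Set S}
  {π : M.Policy} {x : S} {P : Measure (Path S)}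

/-- This is Dynkin's formula with `F (z, z') = f z'` and `G (z, z') = f z`; the drift condition
bounds the rate of `F` by that of `G` plus `ρ w + b`. -/
lemma lintegral_stopped_le (hA : M.Nonexplosion w ρ b L) (hP : IsLaw π (Measure.dirac x) P)
    {I : Set ℝ≥0} (hI : MeasurableSet I) (hIl : IsLowerSet I) {t : ℝ≥0} (hIt : I ⊆ Set.Iic t)
    (c : ℝ≥0) (N : ℕ) :
    ∫⁻ e, stopped (lyap w) I {z | lyap w z ≤ c} N e ∂P ≤ ENNReal.ofReal (w x) +
      ∫⁻ e, ∫⁻ s in Set.Ioi (0 : ℝ), (Prod.fst ⁻¹' I ∩ beforeExit {z | lyap w z ≤ c} N).indicator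
        (fun p => ENNReal.ofReal ρ * lyap w (p.2.xiLeft p.1) + ENNReal.ofReal b)
        (s.toNNReal, e) ∂volume ∂P := by
  have := hP.isProbabilityMeasure
  have hf := measurable_lyap hA.continuous.measurable
  have hV := measurableSet_lyap_le hA c
  obtain ⟨C, hC, hqC⟩ := hA.exists_qStar_le c
  have hZ : MeasurableSet[(filtration S).predictable]
      (Prod.fst ⁻¹' I ∩ beforeExit {z | lyap w z ≤ c} N) :=
    MeasurableSet.inter (measurable_fst_predictable hI) (measurableSet_beforeExit hV N)
  have hdyn := hP.lintegral_stopped_add hI hIl hV hf (F := fun q => lyap w q.2)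
    (G := fun q => lyap w q.1) (hf.comp measurable_snd) (hf.comp measurable_fst)
    (fun z z' => add_comm _ _) N
  set Z : Set (ℝ≥0 × Path S) := Prod.fst ⁻¹' I ∩ beforeExit {z | lyap w z ≤ c} N
  have hmeas : Measurable (Z.indicator (fun p : ℝ≥0 × Path S =>
      ENNReal.ofReal ρ * lyap w (p.2.xiLeft p.1) + ENNReal.ofReal b)) := by
    refine Measurable.mono (mb := inferInstance) ?_ predictable_le_prod le_rfl
    let _ : MeasurableSpace (ℝ≥0 × Path S) := (filtration S).predictable
    exact (((hf.comp measurable_xiLeft_predictable).const_mul _).add_const _).indicator hZ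
  -- Before the exit `w ≤ c` and `q* ≤ C`, so the `G`-term is at most `c * C * t` and can be
  -- cancelled.
  have hfin : ∫⁻ e, ∫⁻ s in Set.Ioi (0 : ℝ),
      Z.indicator (π.rate fun q => lyap w q.1) (s.toNNReal, e) ∂volume ∂P ≠ ∞ := by
    refine ne_top_of_le_ne_top ?_ (lintegral_indicator_le (C := c * C) (fun p hp => hIt hp.1)
      fun p hp h0 => rate_le_of_beforeExit hqC hp.2 h0 fun y => lyap_xiLeft_le hp.2 h0)
    exact ENNReal.mul_ne_top (ENNReal.mul_ne_top ENNReal.coe_ne_top hC) ENNReal.coe_ne_top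
  have hle : ∫⁻ e, ∫⁻ s in Set.Ioi (0 : ℝ),
        Z.indicator (π.rate fun q => lyap w q.2) (s.toNNReal, e) ∂volume ∂P ≤
      ∫⁻ e, ∫⁻ s in Set.Ioi (0 : ℝ),
        Z.indicator (π.rate fun q => lyap w q.1) (s.toNNReal, e) ∂volume ∂P +
      ∫⁻ e, ∫⁻ s in Set.Ioi (0 : ℝ), Z.indicator
        (fun p => ENNReal.ofReal ρ * lyap w (p.2.xiLeft p.1) + ENNReal.ofReal b)
        (s.toNNReal, e) ∂volume ∂P := by
    rw [← lintegral_add_right]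
    · refine lintegral_mono fun e => ?_
      rw [← lintegral_add_right]
      · refine lintegral_mono fun s => ?_
        by_cases hz : (s.toNNReal, e) ∈ Z
        · simp only [Set.indicator_of_mem hz]
          refine π.rate_le_add fun a ha => ?_
          simp only
          generalize e.xiLeft s.toNNReal = z at ha ⊢
          rcases z with y | u
          · obtain ⟨a, ha, rfl⟩ := ha
            exact lintegral_jumpRate_le hA ha
          · simp [jumpRate]
        · simp [Set.indicator_of_notMem hz]
      · exact hmeas.comp (measurable_real_toNNReal.prodMk measurable_const)
    · exact Measurable.lintegral_prod_right
        (hmeas.comp ((measurable_real_toNNReal.comp measurable_snd).prodMk measurable_fst))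
  refine (ENNReal.add_le_add_iff_right hfin).1 ?_
  rw [hdyn, add_assoc]
  refine add_le_add le_rfl (hle.trans_eq (add_comm _ _))

/-- The bound does not depend on `c` or `N`; both nonexplosion and the moment bound rest on this. -/
lemma lintegral_stopped_le_gronwallBound (hA : M.Nonexplosion w ρ b L)
    (hP : IsLaw π (Measure.dirac x) P) (t c : ℝ≥0) (N : ℕ) :
    ∫⁻ e, stopped (lyap w) (Set.Iic t) {z | lyap w z ≤ c} N e ∂P ≤
      ENNReal.ofReal (gronwallBound (w x) ρ b t) := by
  have := hP.isProbabilityMeasure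
  have hf := measurable_lyap hA.continuous.measurable
  have hV := measurableSet_lyap_le hA c
  let B : Set (ℝ≥0 × Path S) := beforeExit {z | lyap w z ≤ c} N
  have hB : MeasurableSet[(filtration S).predictable] B := measurableSet_beforeExit hV N
  have hB' : MeasurableSet B := predictable_le_prod _ hB
  have hxi : Measurable fun p : ℝ≥0 × Path S => lyap w (p.2.xiLeft p.1) :=
    hf.comp (measurable_xiLeft_predictable.mono predictable_le_prod le_rfl)
  have hswap : Measurable fun p : ℝ × Path S => (p.1.toNNReal, p.2) :=
    (measurable_real_toNNReal.comp measurable_fst).prodMk measurable_snd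
  -- Truncation to `B` makes `u` bounded by `c`, as Grönwall's inequality requires; the value of `c`
  -- does not enter the resulting bound.
  let u : ℝ → ℝ≥0∞ := fun s =>
    ∫⁻ e, B.indicator (fun p => lyap w (p.2.xiLeft p.1)) (s.toNNReal, e) ∂P
  have hu : Measurable u := Measurable.lintegral_prod_right ((hxi.indicator hB').comp hswap)
  -- Tonelli's theorem turns the expected time integral into an integral of `ρ u + b`. It is used
  -- with `[0, s)` to obtain the inequality for `u`, and with `[0, t]` for the final estimate.
  have hkey : ∀ (I : Set ℝ≥0) (J : Set ℝ), MeasurableSet I → MeasurableSet J →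
      (∀ s, 0 < s → s.toNNReal ∈ I → s ∈ J) → J ⊆ Set.Ioi 0 →
      ∫⁻ e, ∫⁻ s in Set.Ioi (0 : ℝ), (Prod.fst ⁻¹' I ∩ B).indicator
        (fun p => ENNReal.ofReal ρ * lyap w (p.2.xiLeft p.1) + ENNReal.ofReal b)
        (s.toNNReal, e) ∂volume ∂P ≤
      ∫⁻ s in J, (ENNReal.ofReal ρ * u s + ENNReal.ofReal b) := by
    intro I J hI hJ hIJ hJ0
    have hmeas : Measurable ((Prod.fst ⁻¹' I ∩ B).indicator (fun p : ℝ≥0 × Path S =>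
        ENNReal.ofReal ρ * lyap w (p.2.xiLeft p.1) + ENNReal.ofReal b)) :=
      ((hxi.const_mul _).add_const _).indicator ((measurable_fst hI).inter hB')
    have hae : AEMeasurable (Function.uncurry fun (e : Path S) (s : ℝ) =>
        (Prod.fst ⁻¹' I ∩ B).indicator (fun p : ℝ≥0 × Path S =>
          ENNReal.ofReal ρ * lyap w (p.2.xiLeft p.1) + ENNReal.ofReal b) (s.toNNReal, e))
        (P.prod (volume.restrict (Set.Ioi 0))) :=
      (hmeas.comp ((measurable_real_toNNReal.comp measurable_snd).prodMk
        measurable_fst)).aemeasurable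
    rw [lintegral_lintegral_swap hae]
    have hpt : ∀ s ∈ Set.Ioi (0 : ℝ), ∫⁻ e, (Prod.fst ⁻¹' I ∩ B).indicator
        (fun p => ENNReal.ofReal ρ * lyap w (p.2.xiLeft p.1) + ENNReal.ofReal b)
        (s.toNNReal, e) ∂P ≤
          J.indicator (fun s => ENNReal.ofReal ρ * u s + ENNReal.ofReal b) s := by
      intro s hs
      by_cases hsI : s.toNNReal ∈ I
      · rw [Set.indicator_of_mem (hIJ s hs hsI)]
        have hm : Measurable fun e =>
            B.indicator (fun p => lyap w (p.2.xiLeft p.1)) (s.toNNReal, e) :=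
          (hxi.indicator hB').comp measurable_prodMk_left
        calc _ ≤ ∫⁻ e, (ENNReal.ofReal ρ *
                B.indicator (fun p => lyap w (p.2.xiLeft p.1)) (s.toNNReal, e) +
                  ENNReal.ofReal b) ∂P := by
              refine lintegral_mono fun e => ?_
              by_cases he : (s.toNNReal, e) ∈ B
              · have hIB : (s.toNNReal, e) ∈ Prod.fst ⁻¹' I ∩ B := ⟨hsI, he⟩
                rw [Set.indicator_of_mem he, Set.indicator_of_mem hIB]
              · rw [Set.indicator_of_notMem fun h => he h.2]
                exact zero_le
          _ = _ := by
              rw [lintegral_add_right _ measurable_const, lintegral_const_mul _ hm]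
              simp [u]
      · rw [lintegral_congr (g := fun _ => 0)]
        · simp
        · exact fun e => Set.indicator_of_notMem (fun h => hsI h.1) _
    refine (setLIntegral_mono' measurableSet_Ioi hpt).trans ?_
    rw [lintegral_indicator hJ, Measure.restrict_restrict hJ, Set.inter_eq_left.2 hJ0]
  have huc : ∀ s, 0 < s → u s ≤ c := by
    intro s hs
    have hle : ∀ e, B.indicator (fun p => lyap w (p.2.xiLeft p.1)) (s.toNNReal, e) ≤ c := by
      intro e
      by_cases he : (s.toNNReal, e) ∈ B
      · rw [Set.indicator_of_mem he]
        exact lyap_xiLeft_le he (Real.toNNReal_pos.2 hs).ne'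
      · rw [Set.indicator_of_notMem he]
        exact zero_le
    exact (lintegral_mono hle).trans (by simp)
  have hu1 : ∀ s, 0 < s → u s ≤ ENNReal.ofReal (w x) +
      ∫⁻ r in Set.Ioo 0 s, (ENNReal.ofReal ρ * u r + ENNReal.ofReal b) := by
    intro s hs
    have h1 : u s ≤ ∫⁻ e, stopped (lyap w) (Set.Iio s.toNNReal) {z | lyap w z ≤ c} N e ∂P := by
      refine lintegral_mono fun e => ?_
      by_cases he : (s.toNNReal, e) ∈ B
      · rw [Set.indicator_of_mem he]
        exact le_stopped_Iio (Real.toNNReal_pos.2 hs).ne' rfl he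
      · rw [Set.indicator_of_notMem he]
        exact zero_le
    refine h1.trans ((lintegral_stopped_le hA hP measurableSet_Iio (isLowerSet_Iio _)
      Set.Iio_subset_Iic_self c N).trans (add_le_add le_rfl ?_))
    refine hkey _ _ measurableSet_Iio measurableSet_Ioo (fun r hr h => ⟨hr, ?_⟩)
      fun r hr => hr.1
    exact (Real.toNNReal_lt_toNNReal_iff hs).1 h
  refine (lintegral_stopped_le hA hP measurableSet_Iic (isLowerSet_Iic t) le_rfl c N).trans ?_
  refine (add_le_add le_rfl (hkey (Set.Iic t) (Set.Ioc 0 (t : ℝ)) measurableSet_Iic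
    measurableSet_Ioc (fun r hr h => ⟨hr, Real.toNNReal_le_iff_le_coe.1 h⟩)
      fun r hr => hr.1)).trans ?_
  exact lintegral_le_gronwallBound hu ENNReal.coe_ne_top huc
    (zero_le_one.trans (hA.one_le x)) hA.rho_nonneg hA.b_nonneg hu1 t.2

/-- The expected number of jumps before the exit from a sublevel set of `w` is finite. -/
lemma exists_mul_measure_live_le (hA : M.Nonexplosion w ρ b L) (hP : IsLaw π (Measure.dirac x) P)
    (t c : ℝ≥0) : ∃ C : ℝ≥0∞, C ≠ ∞ ∧
      ∀ N : ℕ, N * P (live (Set.Iic t) {z | lyap w z ≤ c} N) ≤ C := by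
  have := hP.isProbabilityMeasure
  have hV := measurableSet_lyap_le hA c
  obtain ⟨C, hC, hqC⟩ := hA.exists_qStar_le c
  refine ⟨1 * C * t, ENNReal.mul_ne_top (ENNReal.mul_ne_top ENNReal.one_ne_top hC)
    ENNReal.coe_ne_top, fun N => ?_⟩
  have h := hP.lintegral_sum_live (I := Set.Iic t) measurableSet_Iic hV (F := fun _ => 1)
    measurable_const N
  have hle : ∫⁻ e, ∑ k ∈ Finset.range N, (live (Set.Iic t) {z | lyap w z ≤ c} (k + 1)).indicator
      (fun _ => (1 : ℝ≥0∞)) e ∂P ≤ 1 * C * t := by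
    rw [h]
    exact lintegral_indicator_le (fun p hp => hp.1)
      fun p hp h0 => rate_le_of_beforeExit hqC hp.2 h0 fun y => le_rfl
  refine le_trans ?_ hle
  have hm : ∀ k, MeasurableSet (live (Set.Iic t) {z | lyap w z ≤ c} (k + 1)) := fun k =>
    measurableSet_live measurableSet_Iic hV (k + 1)
  rw [lintegral_finsetSum _ fun k _ => measurable_const.indicator (hm k)]
  -- Each of the first `N` live events contains the `N`-th, so the expected number of live jumps is
  -- at least `N` times its probability.
  have : ∀ k ∈ Finset.range N, P (live (Set.Iic t) {z | lyap w z ≤ c} N) ≤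
      ∫⁻ e, (live (Set.Iic t) {z | lyap w z ≤ c} (k + 1)).indicator
        (fun _ => (1 : ℝ≥0∞)) e ∂P := by
    intro k hk
    rw [lintegral_indicator_const (hm k), one_mul]
    exact measure_mono (live_antitone (isLowerSet_Iic t) (Finset.mem_range.1 hk))
  refine le_trans ?_ (Finset.sum_le_sum this)
  simp

lemma measure_explosionTime_le (hA : M.Nonexplosion w ρ b L) (hP : IsLaw π (Measure.dirac x) P)
    (t : ℝ≥0) : P {e | e.explosionTime ≤ t} = 0 := by
  have := hP.isProbabilityMeasure
  have hf := measurable_lyap hA.continuous.measurable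
  have hbound : ∀ n : ℕ, n ≠ 0 → P {e | e.explosionTime ≤ t} ≤
      ENNReal.ofReal (gronwallBound (w x) ρ b t) / n := by
    intro n hn
    obtain ⟨C, hC, hlive⟩ := exists_mul_measure_live_le hA hP t n
    -- The level `n` stays fixed while `N → ∞`, because `C` depends on `n`; the Markov term does not
    -- depend on `N`.
    have hN : ∀ N : ℕ, P {e | e.explosionTime ≤ t} ≤
        C / (N + 1 : ℕ) + ENNReal.ofReal (gronwallBound (w x) ρ b t) / n := by
      intro N
      have hsub : {e : Path S | e.explosionTime ≤ t} ⊆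
          live (Set.Iic t) {z | lyap w z ≤ (n : ℝ≥0)} (N + 1) ∪
          {e | (n : ℝ≥0∞) ≤ stopped (lyap w) (Set.Iic t) {z | lyap w z ≤ (n : ℝ≥0)} (N + 1) e} := by
        intro e he
        rcases mem_live_or_lt_stopped (f := lyap w) he (n : ℝ≥0) (N + 1) with h | h
        · exact Or.inl h
        · exact Or.inr (by simpa using h.le)
      refine (measure_mono hsub).trans ((measure_union_le _ _).trans (add_le_add ?_ ?_))
      · rw [ENNReal.le_div_iff_mul_le (Or.inl (by simp)) (Or.inl (by simp)), mul_comm]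
        exact hlive (N + 1)
      · rw [ENNReal.le_div_iff_mul_le (Or.inl (by simpa using hn)) (Or.inl (by simp)), mul_comm]
        exact (mul_meas_ge_le_lintegral (measurable_stopped measurableSet_Iic
          (measurableSet_lyap_le hA _) hf _) _).trans
          (lintegral_stopped_le_gronwallBound hA hP t n (N + 1))
    have hlim : Tendsto (fun N : ℕ => C / (N + 1 : ℕ) +
        ENNReal.ofReal (gronwallBound (w x) ρ b t) / n) atTop
        (𝓝 (C / ∞ + ENNReal.ofReal (gronwallBound (w x) ρ b t) / n)) :=
      (ENNReal.Tendsto.const_div (ENNReal.tendsto_nat_nhds_top.comp (tendsto_add_atTop_nat 1))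
        (Or.inr hC)).add tendsto_const_nhds
    simpa using ge_of_tendsto' hlim hN
  have hlim : Tendsto (fun n : ℕ => ENNReal.ofReal (gronwallBound (w x) ρ b t) / n) atTop
      (𝓝 (ENNReal.ofReal (gronwallBound (w x) ρ b t) / ∞)) :=
    ENNReal.Tendsto.const_div ENNReal.tendsto_nat_nhds_top (Or.inr ENNReal.ofReal_ne_top)
  have := ge_of_tendsto hlim ((eventually_ne_atTop 0).mono hbound)
  simpa using this

lemma ae_explosionTime_eq_top (hA : M.Nonexplosion w ρ b L)
    (hP : IsLaw π (Measure.dirac x) P) : ∀ᵐ e ∂P, e.explosionTime = ∞ := by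
  have h : ∀ᵐ e ∂P, ∀ n : ℕ, ¬e.explosionTime ≤ ((n : ℝ≥0) : ℝ≥0∞) := by
    rw [ae_all_iff]
    intro n
    rw [ae_iff]
    simpa using measure_explosionTime_le hA hP n
  filter_upwards [h] with e he
  by_contra htop
  obtain ⟨n, hn⟩ := ENNReal.exists_nat_gt htop
  exact he n (by simpa using hn.le)

/-- Fatou's lemma along the stopped processes, with level and number of jumps both equal to `n`. -/
lemma lintegral_lyap_xi_le (hA : M.Nonexplosion w ρ b L) (hP : IsLaw π (Measure.dirac x) P)
    (t : ℝ≥0) :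
    ∫⁻ e, lyap w (e.xi t) ∂P ≤ ENNReal.ofReal (gronwallBound (w x) ρ b t) := by
  have hf := measurable_lyap hA.continuous.measurable
  refine (lintegral_mono fun e => lyap_xi_le_liminf e t).trans ?_
  refine (lintegral_liminf_le fun n => measurable_stopped measurableSet_Iic
    (measurableSet_lyap_le hA _) hf n).trans ?_
  refine liminf_le_of_le (by isBoundedDefault) fun a ha => ?_
  obtain ⟨n, hn⟩ := ha.exists
  exact hn.trans (lintegral_stopped_le_gronwallBound hA hP t n n)

lemma integrable_xi_and_integral_le (hA : M.Nonexplosion w ρ b L)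
    (hP : IsLaw π (Measure.dirac x) P) (t : ℝ≥0) :
    Integrable (fun e => Sum.elim w (fun _ => 0) (e.xi t)) P ∧
      ∫ e, Sum.elim w (fun _ => 0) (e.xi t) ∂P ≤ gronwallBound (w x) ρ b t := by
  have hm : Measurable (Sum.elim w (fun _ => 0) : Ext S → ℝ) :=
    hA.continuous.measurable.sumElim measurable_const
  have hnonneg : ∀ z : Ext S, 0 ≤ (Sum.elim w (fun _ => 0) z : ℝ) := by
    rintro (y | u)
    · exact zero_le_one.trans (hA.one_le y)
    · exact le_rfl
  have hof : ∀ z : Ext S, ENNReal.ofReal (Sum.elim w (fun _ => 0) z) = lyap w z := by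
    rintro (y | u) <;> simp [lyap]
  have hle := lintegral_lyap_xi_le hA hP t
  have haes : AEStronglyMeasurable (fun e : Path S => (Sum.elim w (fun _ => 0) (e.xi t) : ℝ)) P :=
    (hm.comp (measurable_xi t)).aestronglyMeasurable
  have hg : 0 ≤ gronwallBound (w x) ρ b t :=
    (gronwallBound_mono (zero_le_one.trans (hA.one_le x)) hA.b_nonneg hA.rho_nonneg t.2).trans'
      (by simp [gronwallBound_x0, zero_le_one.trans (hA.one_le x)])
  refine ⟨⟨haes, ?_⟩, ?_⟩
  · rw [hasFiniteIntegral_iff_ofReal (ae_of_all _ fun e => hnonneg _)]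
    simp only [hof]
    exact hle.trans_lt ENNReal.ofReal_lt_top
  · rw [integral_eq_lintegral_of_nonneg_ae (ae_of_all _ fun e => hnonneg _) haes]
    simp only [hof]
    exact ENNReal.toReal_le_of_le_ofReal hg hle

end Lyapunov

end Model

/-! ### Entrances, exits and the forward equation. -/

namespace Model

open CTMDP.Path

section Transitions

variable {S : Type*}

/-- Indicator of the transitions that enter `D`. -/
noncomputable def entering (D : Set S) : Ext S × Ext S → ℝ≥0∞ :=
  ((Sum.inl '' D)ᶜ ×ˢ (Sum.inl '' D)).indicator 1

/-- Indicator of the transitions that leave `D`. -/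
noncomputable def leaving (D : Set S) : Ext S × Ext S → ℝ≥0∞ :=
  ((Sum.inl '' D) ×ˢ (Sum.inl '' D)ᶜ).indicator 1

/-- Indicator of `D` on the extended state space. -/
noncomputable def inside (D : Set S) : Ext S → ℝ≥0∞ := (Sum.inl '' D).indicator 1

lemma inside_add_entering (D : Set S) (z z' : Ext S) :
    inside D z + entering D (z, z') = inside D z' + leaving D (z, z') := by
  classical
  by_cases h : z ∈ Sum.inl '' D <;> by_cases h' : z' ∈ Sum.inl '' D <;>
    simp only [inside, entering, leaving, Set.indicator, Set.mem_prod, Set.mem_compl_iff, h, h'] <;>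
    simp

/-- Without explosion, the indicator of `D` at time `t` is its initial value plus the number of
entrances minus the number of exits. -/
lemma inside_xi_add_tsum (D : Set S) {e : Path S} (he : e.explosionTime = ∞) (t : ℝ≥0) :
    inside D (e.xi t) + ∑' k, (live (Set.Iic t) Set.univ (k + 1)).indicator
        (fun e => leaving D (e.state k, e.state (k + 1))) e =
      inside D (e.state 0) + ∑' k, (live (Set.Iic t) Set.univ (k + 1)).indicator
        (fun e => entering D (e.state k, e.state (k + 1))) e := by
  obtain ⟨k, h1, h2⟩ := e.exists_jumpTime_le_lt (t := t) (by simp [he])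
  have hk : e ∈ live (Set.Iic t) Set.univ k := mem_live_Iic_iff.2 ⟨h1, fun _ _ => trivial⟩
  -- With `V = univ`, `live` only says that the epoch is at most `t`; without explosion this holds
  -- for finitely many jumps and both series are finite sums.
  have hzero : ∀ j ∉ Finset.range k, e ∉ live (Set.Iic t) Set.univ (j + 1) := by
    intro j hj h
    have hle := e.jumpTime_mono (show k + 1 ≤ j + 1 by simpa using hj)
    exact h2.not_ge (hle.trans (mem_live_Iic_iff.1 h).1)
  rw [e.xi_eq_state h1 h2, tsum_eq_sum fun j hj => Set.indicator_of_notMem (hzero j hj) _,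
    tsum_eq_sum fun j hj => Set.indicator_of_notMem (hzero j hj) _,
    ← stopped_add_sum (isLowerSet_Iic t) (inside_add_entering D), stopped_of_mem_live hk]

variable [MeasurableSpace S] {D : Set S}

lemma measurable_entering (hD : MeasurableSet D) : Measurable (entering D) :=
  measurable_one.indicator
    ((measurableSet_inl_image.2 hD).compl.prod (measurableSet_inl_image.2 hD))

lemma measurable_leaving (hD : MeasurableSet D) : Measurable (leaving D) :=
  measurable_one.indicator
    ((measurableSet_inl_image.2 hD).prod (measurableSet_inl_image.2 hD).compl)

lemma measurable_inside (hD : MeasurableSet D) : Measurable (inside D) :=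
  measurable_one.indicator (measurableSet_inl_image.2 hD)

end Transitions

variable {S A : Type*} [MeasurableSpace S] [MeasurableSpace A] {M : Model S A}

/-- The sign is decided by whether `z` lies in `D`, uniformly in the action; therefore positive
parts commute with integration over actions. -/
lemma qExt_sign {D : Set S} (hD : MeasurableSet D) (z : Ext S) :
    (∀ a ∈ M.admExt z, 0 ≤ M.qExt z a D) ∨ (∀ a ∈ M.admExt z, M.qExt z a D ≤ 0) := by
  rcases z with x | u
  · by_cases hx : x ∈ D
    · right
      rintro _ ⟨a, ha, rfl⟩
      exact q_nonpos ha hD hx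
    · left
      rintro _ ⟨a, ha, rfl⟩
      exact M.q_nonneg x a ha D hD hx
  · left
    simp [qExt]

/-- The rates are measurable only on the graph `K` and arbitrary off it, so they are extended by `0`
from `K`; policies charge only admissible actions and do not see the change. -/
lemma exists_measurable_qExt {D : Set S} (hD : MeasurableSet D) :
    ∃ Q : Ext S × Ext A → ℝ, Measurable Q ∧ ∀ z, ∀ a ∈ M.admExt z, Q (z, a) = M.qExt z a D := by
  have hinlS : MeasurableEmbedding (Sum.inl : S → Ext S) :=
    ⟨Sum.inl_injective, measurable_inl, fun {_} hs => measurableSet_inl_image.2 hs⟩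
  have hinlA : MeasurableEmbedding (Sum.inl : A → Ext A) :=
    ⟨Sum.inl_injective, measurable_inl, fun {_} hs => measurableSet_inl_image.2 hs⟩
  have hι : MeasurableEmbedding
      (Prod.map Sum.inl Sum.inl ∘ Subtype.val :
        {p : S × A // p.2 ∈ M.adm p.1} → Ext S × Ext A) :=
    (hinlS.prodMap hinlA).comp (MeasurableEmbedding.subtype_coe M.measurableSet_graph)
  refine ⟨Function.extend _ (fun p : {p : S × A // p.2 ∈ M.adm p.1} => M.q p.1.1 p.1.2 D)
    (fun _ => 0), hι.measurable_extend (M.measurable_q D hD) measurable_const, ?_⟩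
  rintro (x | u) a ha
  · obtain ⟨a, ha, rfl⟩ := ha
    exact hι.injective.extend_apply _ _ (⟨(x, a), ha⟩ : {p : S × A // p.2 ∈ M.adm p.1})
  · rw [Function.extend_apply']
    · simp [qExt]
    · rintro ⟨p, hp⟩
      exact Sum.inl_ne_inr (Prod.mk.inj hp).1

lemma lintegral_ofReal_of_sign {X : Type*} [MeasurableSpace X] {μ : Measure X} {h : X → ℝ}
    (hi : Integrable h μ) (hs : 0 ≤ᵐ[μ] h ∨ h ≤ᵐ[μ] 0) :
    ∫⁻ a, ENNReal.ofReal (h a) ∂μ = ENNReal.ofReal (∫ a, h a ∂μ) := by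
  rcases hs with hs | hs
  · exact (ofReal_integral_eq_lintegral_ofReal hi hs).symm
  · rw [ENNReal.ofReal_of_nonpos (integral_nonpos_of_ae hs),
      lintegral_congr_ae (hs.mono fun a ha => ENNReal.ofReal_of_nonpos ha), lintegral_zero]

/-- The predictable process `∫ π(da|e,t) q(D|ξ_{t-}, a)`. -/
noncomputable def Policy.drift (π : M.Policy) (D : Set S) (p : ℝ≥0 × Path S) : ℝ :=
  ∫ a, M.qExt (p.2.xiLeft p.1) a D ∂π.kernel p

lemma measurable_drift (π : M.Policy) {D : Set S} (hD : MeasurableSet D) :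
    Measurable (π.drift D) := by
  refine Measurable.mono (mb := inferInstance) ?_ predictable_le_prod le_rfl
  let _ : MeasurableSpace (ℝ≥0 × Path S) := (filtration S).predictable
  have := π.isMarkovKernel
  obtain ⟨Q, hQ, hQq⟩ := M.exists_measurable_qExt hD
  have hQm : Measurable (Function.uncurry fun (p : ℝ≥0 × Path S) (a : Ext A) =>
      Q (p.2.xiLeft p.1, a)) :=
    hQ.comp ((measurable_xiLeft_predictable.comp measurable_fst).prodMk measurable_snd)
  have h : π.drift D = fun p => ∫ a, Q (p.2.xiLeft p.1, a) ∂π.kernel p := by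
    ext p
    exact integral_congr_ae ((π.ae_mem_admExt p).mono fun a ha => (hQq _ a ha).symm)
  rw [h]
  exact (StronglyMeasurable.integral_kernel_prod_right (κ := π.kernel)
    hQm.stronglyMeasurable).measurable

section TransitionRates

variable [MeasurableSingletonClass S] {D : Set S}

lemma lintegral_entering (hD : MeasurableSet D) {z : Ext S} {a : Ext A} (ha : a ∈ M.admExt z) :
    ∫⁻ y, entering D (z, Sum.inl y) ∂M.jumpRate z a = ENNReal.ofReal (M.qExt z a D) := by
  rcases z with x | u
  · obtain ⟨a, ha, rfl⟩ := ha
    by_cases hx : x ∈ D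
    · rw [qExt, ENNReal.ofReal_of_nonpos (q_nonpos ha hD hx)]
      simp [entering, hx]
    · rw [qExt, ← jumpRate_of_notMem ha hD hx, ← lintegral_indicator_one hD]
      refine lintegral_congr fun y => ?_
      classical
      simp [entering, Set.indicator, hx]
  · simp [jumpRate, qExt]

lemma lintegral_leaving (hD : MeasurableSet D) {z : Ext S} {a : Ext A} (ha : a ∈ M.admExt z) :
    ∫⁻ y, leaving D (z, Sum.inl y) ∂M.jumpRate z a = ENNReal.ofReal (-M.qExt z a D) := by
  rcases z with x | u
  · obtain ⟨a, ha, rfl⟩ := ha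
    by_cases hx : x ∈ D
    · rw [qExt, ← jumpRate_compl ha hD hx, ← lintegral_indicator_one hD.compl]
      refine lintegral_congr fun y => ?_
      classical
      simp [leaving, Set.indicator, hx]
    · rw [qExt, ENNReal.ofReal_of_nonpos (neg_nonpos.2 (M.q_nonneg x a ha D hD hx))]
      simp [leaving, hx]
  · simp [jumpRate, qExt]

lemma exists_abs_qExt_le (hD : MeasurableSet D) (z : Ext S) :
    ∃ C : ℝ, ∀ a ∈ M.admExt z, |M.qExt z a D| ≤ C := by
  rcases z with x | u
  · refine ⟨(M.qStar x).toReal, ?_⟩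
    rintro _ ⟨a, ha, rfl⟩
    exact abs_q_le ha hD
  · exact ⟨0, by simp [qExt]⟩

lemma integrable_qExt (π : M.Policy) (hD : MeasurableSet D) (p : ℝ≥0 × Path S) :
    Integrable (fun a => M.qExt (p.2.xiLeft p.1) a D) (π.kernel p) := by
  have := π.isProbabilityMeasure p
  obtain ⟨Q, hQ, hQq⟩ := M.exists_measurable_qExt hD
  obtain ⟨C, hC⟩ := M.exists_abs_qExt_le hD (p.2.xiLeft p.1)
  have hae : AEStronglyMeasurable (fun a => M.qExt (p.2.xiLeft p.1) a D) (π.kernel p) :=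
    (hQ.comp measurable_prodMk_left).aestronglyMeasurable.congr
      ((π.ae_mem_admExt p).mono fun a ha => hQq _ a ha)
  exact Integrable.of_bound hae C ((π.ae_mem_admExt p).mono hC)

lemma rate_entering (π : M.Policy) (hD : MeasurableSet D) (p : ℝ≥0 × Path S) :
    π.rate (entering D) p = ENNReal.ofReal (π.drift D p) := by
  have hae := π.ae_mem_admExt p
  rw [Policy.drift, ← lintegral_ofReal_of_sign (integrable_qExt π hD p)]
  · exact lintegral_congr_ae (hae.mono fun a ha => lintegral_entering hD ha)
  · exact (qExt_sign hD (p.2.xiLeft p.1)).imp hae.mono hae.mono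

lemma rate_leaving (π : M.Policy) (hD : MeasurableSet D) (p : ℝ≥0 × Path S) :
    π.rate (leaving D) p = ENNReal.ofReal (-π.drift D p) := by
  have hae := π.ae_mem_admExt p
  rw [Policy.drift, ← integral_neg, ← lintegral_ofReal_of_sign (integrable_qExt π hD p).fun_neg]
  · exact lintegral_congr_ae (hae.mono fun a ha => lintegral_leaving hD ha)
  · exact (qExt_sign hD (p.2.xiLeft p.1)).symm.imp
      (fun h => hae.mono fun a ha => neg_nonneg.2 (h a ha))
      (fun h => hae.mono fun a ha => neg_nonpos.2 (h a ha))

/-- Only a state of `D` can be left, so boundedness of `q*` on `D` suffices to control the exits. -/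
lemma rate_leaving_le (π : M.Policy) (p : ℝ≥0 × Path S) :
    π.rate (leaving D) p ≤ ⨆ y ∈ D, M.qStar y := by
  refine π.rate_le fun a ha => ?_
  generalize p.2.xiLeft p.1 = z at ha
  rcases z with x | u
  · obtain ⟨a, ha, rfl⟩ := ha
    by_cases hx : x ∈ D
    · refine (lintegral_mono (g := fun _ => 1) fun y => ?_).trans ?_
      · exact Set.indicator_le_self' (f := (1 : Ext S × Ext S → ℝ≥0∞)) (fun _ _ => zero_le) _
      · rw [lintegral_one]
        exact (jumpRate_univ_le ha).trans (le_iSup₂ (f := fun x (_ : x ∈ D) => M.qStar x) x hx)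
    · simp [leaving, hx]
  · simp [jumpRate]

lemma IsLaw.lintegral_tsum_live {π : M.Policy} {γ : Measure S} {P : Measure (Path S)}
    (hP : IsLaw π γ P) {F : Ext S × Ext S → ℝ≥0∞} (hF : Measurable F) (t : ℝ≥0) :
    ∫⁻ e, ∑' k, (live (Set.Iic t) Set.univ (k + 1)).indicator
        (fun e => F (e.state k, e.state (k + 1))) e ∂P =
      ∫⁻ e, ∫⁻ s in Set.Ioc (0 : ℝ) t, π.rate F (s.toNNReal, e) ∂volume ∂P := by
  have h := hP.lintegral_tsum_jumps (measurable_fst_predictable (measurableSet_Iic (a := t))) hF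
  convert h using 1
  · refine lintegral_congr fun e => tsum_congr fun k => ?_
    have : live (Set.Iic t) (Set.univ : Set (Ext S)) (k + 1) = {e : Path S |
        e.jumpTime (k + 1) ≠ ∞ ∧
          ((e.jumpTime (k + 1)).toNNReal, e) ∈ Prod.fst ⁻¹' Set.Iic t} := by
      ext e
      simp [live]
    rw [this]
  · refine lintegral_congr fun e => ?_
    have hind : ∀ s ∈ Set.Ioi (0 : ℝ),
        (Prod.fst ⁻¹' Set.Iic t).indicator (π.rate F) (s.toNNReal, e) =
          (Set.Iic (t : ℝ)).indicator (fun s => π.rate F (s.toNNReal, e)) s := by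
      classical
      intro s hs
      simp only [Set.indicator, Set.mem_preimage, Set.mem_Iic, Real.toNNReal_le_iff_le_coe]
    rw [setLIntegral_congr_fun measurableSet_Ioi hind, lintegral_indicator measurableSet_Iic,
      Measure.restrict_restrict measurableSet_Iic, Set.inter_comm, Set.Ioi_inter_Iic]

end TransitionRates

/-- Kolmogorov's forward equation. -/
lemma forward_equation [TopologicalSpace S] [MeasurableSingletonClass S] [OpensMeasurableSpace S]
    {w : S → ℝ} {ρ b : ℝ} {L : ℕ → Set S} {π : M.Policy} {x : S} {P : Measure (Path S)}
    (hA : M.Nonexplosion w ρ b L) (hP : IsLaw π (Measure.dirac x) P) (t : ℝ≥0) {D : Set S}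
    (hD : MeasurableSet D) (hq : (⨆ y ∈ D, M.qStar y) < ∞) :
    Integrable (fun p : Path S × ℝ => π.drift D (p.2.toNNReal, p.1))
        (P.prod (volume.restrict (Set.Ioc 0 (t : ℝ)))) ∧
      P.real {e | ∃ y ∈ D, e.xi t = Sum.inl y} = D.indicator (fun _ => (1 : ℝ)) x +
        ∫ e, (∫ s in (0 : ℝ)..t, π.drift D (s.toNNReal, e)) ∂P := by
  have := hP.isProbabilityMeasure
  set μ := P.prod (volume.restrict (Set.Ioc 0 (t : ℝ))) with hμ
  have hdm : Measurable fun p : Path S × ℝ => π.drift D (p.2.toNNReal, p.1) :=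
    (measurable_drift π hD).comp
      ((measurable_real_toNNReal.comp measurable_snd).prodMk measurable_fst)
  have hpos : ∫⁻ p, ENNReal.ofReal (π.drift D (p.2.toNNReal, p.1)) ∂μ =
      ∫⁻ e, ∫⁻ s in Set.Ioc (0 : ℝ) t, π.rate (entering D) (s.toNNReal, e) ∂volume ∂P := by
    rw [hμ, lintegral_prod _ hdm.ennreal_ofReal.aemeasurable]
    simp only [rate_entering π hD]
  have hneg : ∫⁻ p, ENNReal.ofReal (-π.drift D (p.2.toNNReal, p.1)) ∂μ =
      ∫⁻ e, ∫⁻ s in Set.Ioc (0 : ℝ) t, π.rate (leaving D) (s.toNNReal, e) ∂volume ∂P := by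
    rw [hμ, lintegral_prod _ hdm.fun_neg.ennreal_ofReal.aemeasurable]
    simp only [rate_leaving π hD]
  have hset : {e : Path S | ∃ y ∈ D, e.xi t = Sum.inl y} =
      (fun e => e.xi t) ⁻¹' (Sum.inl '' D) := by
    ext e
    simp [eq_comm]
  have hxi : ∫⁻ e, inside D (e.xi t) ∂P = P {e | ∃ y ∈ D, e.xi t = Sum.inl y} := by
    rw [hset, ← lintegral_indicator_one (measurable_xi t (measurableSet_inl_image.2 hD))]
    rfl
  -- This is the expectation of the pathwise balance, with exits added on the left since neither
  -- count is known to be finite yet.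
  have hbal : P {e | ∃ y ∈ D, e.xi t = Sum.inl y} +
      ∫⁻ p, ENNReal.ofReal (-π.drift D (p.2.toNNReal, p.1)) ∂μ =
      inside D (Sum.inl x) + ∫⁻ p, ENNReal.ofReal (π.drift D (p.2.toNNReal, p.1)) ∂μ := by
    rw [hpos, hneg, ← hP.lintegral_tsum_live (measurable_entering hD),
      ← hP.lintegral_tsum_live (measurable_leaving hD), ← hxi,
      ← hP.lintegral_state_zero (measurable_inside hD),
      ← lintegral_add_left (f := fun e : Path S => inside D (e.xi t))
        ((measurable_inside hD).comp (measurable_xi t)),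
      ← lintegral_add_left (f := fun e : Path S => inside D (e.state 0))
        ((measurable_inside hD).comp (measurable_state 0))]
    exact lintegral_congr_ae ((ae_explosionTime_eq_top hA hP).mono fun e he =>
      inside_xi_add_tsum D he t)
  have hnegfin : ∫⁻ p, ENNReal.ofReal (-π.drift D (p.2.toNNReal, p.1)) ∂μ ≠ ∞ := by
    rw [hneg]
    refine ne_top_of_le_ne_top ?_ (lintegral_mono fun e => lintegral_mono fun s =>
      rate_leaving_le π (s.toNNReal, e))
    simp [ENNReal.mul_eq_top, hq.ne]
  -- Finiteness passes from exits to entrances through `hbal`, because its remaining left-hand term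
  -- is a probability.
  have hposfin : ∫⁻ p, ENNReal.ofReal (π.drift D (p.2.toNNReal, p.1)) ∂μ ≠ ∞ := by
    refine ne_top_of_le_ne_top (ENNReal.add_ne_top.2 ⟨measure_ne_top P _, hnegfin⟩)
      (le_add_self.trans_eq hbal.symm)
  have hint : Integrable (fun p : Path S × ℝ => π.drift D (p.2.toNNReal, p.1)) μ := by
    refine ⟨hdm.aestronglyMeasurable, ?_⟩
    have hnorm : ∀ r : ℝ, ‖r‖ₑ ≤ ENNReal.ofReal r + ENNReal.ofReal (-r) := by
      intro r
      rw [← ofReal_norm, Real.norm_eq_abs]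
      rcases le_total 0 r with h | h
      · rw [abs_of_nonneg h]
        exact le_self_add
      · rw [abs_of_nonpos h]
        exact le_add_self
    refine (lintegral_mono fun p => hnorm _).trans_lt ?_
    rw [lintegral_add_left hdm.ennreal_ofReal]
    exact ENNReal.add_lt_top.2 ⟨hposfin.lt_top, hnegfin.lt_top⟩
  refine ⟨hint, ?_⟩
  have hprod := integral_prod _ hint
  simp only [intervalIntegral.integral_of_le (NNReal.coe_nonneg t)]
  rw [← hprod, integral_eq_lintegral_pos_part_sub_lintegral_neg_part hint]
  have hx : (inside D (Sum.inl x)).toReal = D.indicator (fun _ => (1 : ℝ)) x := by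
    classical
    by_cases hx : x ∈ D <;> simp [inside, hx]
  have hxfin : inside D (Sum.inl x) ≠ ∞ := by
    classical
    by_cases hx : x ∈ D <;> simp [inside, hx]
  have hreal := congrArg ENNReal.toReal hbal
  rw [ENNReal.toReal_add (measure_ne_top P _) hnegfin, ENNReal.toReal_add hxfin hposfin, hx]
    at hreal
  rw [Measure.real]
  linarith

end Model

end CTMDP

/-! ### The three conclusions. -/

theorem theoremt2 {S A : Type*}
    [TopologicalSpace S] [PolishSpace S] [MeasurableSpace S] [BorelSpace S]
    [TopologicalSpace A] [PolishSpace A] [MeasurableSpace A] [BorelSpace A]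
    (M : CTMDP.Model S A) (w : S → ℝ) (ρ b : ℝ) (L : ℕ → Set S)
    (hA : M.Nonexplosion w ρ b L)
    (π : M.Policy) (x : S) (P : Measure (CTMDP.Path S))
    (hP : CTMDP.Model.IsLaw π (Measure.dirac x) P) (t : ℝ≥0) :
    (P {e | e.explosionTime = ∞} = 1 ∧ P {e | ∃ y : S, e.xi t = Sum.inl y} = 1) ∧
    (Integrable (fun e => Sum.elim w (fun _ => 0) (e.xi t)) P ∧
      (ρ ≠ 0 → ∫ e, Sum.elim w (fun _ => 0) (e.xi t) ∂P ≤
        Real.exp (ρ * t) * w x + b / ρ * (Real.exp (ρ * t) - 1)) ∧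
      (ρ = 0 → ∫ e, Sum.elim w (fun _ => 0) (e.xi t) ∂P ≤ w x + b * t)) ∧
    ∀ D : Set S, MeasurableSet D → (⨆ y ∈ D, M.qStar y) < ∞ →
      (∀ (s : ℝ≥0) (e : CTMDP.Path S),
        Integrable (fun a => M.qExt (e.xiLeft s) a D) (π.kernel (s, e))) ∧
      Integrable (fun p : CTMDP.Path S × ℝ =>
          ∫ a, M.qExt (p.1.xiLeft p.2.toNNReal) a D ∂π.kernel (p.2.toNNReal, p.1))
        (P.prod (volume.restrict (Set.Ioc 0 (t : ℝ)))) ∧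
      P.real {e | ∃ y ∈ D, e.xi t = Sum.inl y} =
        D.indicator (fun _ => (1 : ℝ)) x +
          ∫ e, (∫ s in (0 : ℝ)..t,
            (∫ a, M.qExt (e.xiLeft s.toNNReal) a D ∂π.kernel (s.toNNReal, e))) ∂P := by
  have := hP.isProbabilityMeasure
  have hexp := CTMDP.Model.ae_explosionTime_eq_top hA hP
  obtain ⟨hint, hle⟩ := CTMDP.Model.integrable_xi_and_integral_le hA hP t
  refine ⟨⟨?_, ?_⟩, ⟨hint, fun hρ => ?_, fun hρ => ?_⟩, fun D hD hq =>
    ⟨fun s e => CTMDP.Model.integrable_qExt π hD (s, e),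
      CTMDP.Model.forward_equation hA hP t hD hq⟩⟩
  · rw [← measure_univ (μ := P)]
    exact measure_congr (eventuallyEq_univ.2 hexp)
  · rw [← measure_univ (μ := P)]
    exact measure_congr (eventuallyEq_univ.2
      (hexp.mono fun e he => CTMDP.Model.exists_xi_eq_inl he t))
  · rw [gronwallBound_of_K_ne_0 hρ] at hle
    linarith
  · rw [hρ, gronwallBound_K0] at hle
    exact hle
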